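/- A \emph{chain} with $n\ge 1$ chain edges is a sequence $C=(p_0,\dots,p_n)$ of points in $\mathbb{R}^2$, sorted by strictly increasing $x$-coordinates and with no three points on a line, such that each of the edges $p_{i-1}p_i$ ($1\le i\le n$), the \emph{chain edges}, is contained in every triangulation of $\{p_0,\dots,p_n\}$; here a triangulation is an edge-maximal crossing-free straight-line graph with vertex set $\{p_0,\dots,p_n\}$. Let $\mathrm{tr}(C)$ be the number of triangulations. The chain is represented by its visibility triangle $V(C)$: for $0\le i<j\le n$, the entry $V(C)_{i,j}$ is $0$ if $j=i+1$, $+1$ if the edge $p_ip_j$ lies above the chain curve $p_0p_1\cdots p_n$, and $-1$ if it lies below it. Theorem. Given a chain $C$ with $n\ge 1$ chain edges as input (by $n$ and its visibility triangle), the number $\mathrm{tr}(C)$ can be computed with only $O(n^2)$ integer additions and multiplications. More precisely, there are a single program for a random access machine, whose only arithmetic operations are integer addition and multiplication (each at unit cost), and an absolute constant $c$ such that, for every $n \ge 1$ and every chain $C$ with $n$ chain edges, the program computes $\mathrm{tr}(C)$ in at most $c\,n^2$ elementary steps, where every addition, multiplication, constant, memory access and test counts as a step. -/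

import Mathlib

/-! ## Planar point sets and their triangulations -/

/-- General position for points sorted by increasing `x`-coordinate: the `x`-coordinates are
strictly increasing (in particular pairwise distinct) and no three points are on a line. -/
structure SortedGeneralPosition {m : ℕ} (p : Fin m → ℝ × ℝ) : Prop where
  x_strictMono : StrictMono fun i => (p i).1
  not_collinear : ∀ i j k : Fin m, i < j → j < k → ¬ Collinear ℝ {p i, p j, p k}

/-- The geometric graph with vertices `p i` and a straight-line segment for every edge of `G` is
crossing-free: distinct edges meet only in common endpoints. -/
def CrossingFree {m : ℕ} (p : Fin m → ℝ × ℝ) (G : SimpleGraph (Fin m)) : Prop :=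
  ∀ a b c d : Fin m, G.Adj a b → G.Adj c d → s(a, b) ≠ s(c, d) →
    segment ℝ (p a) (p b) ∩ segment ℝ (p c) (p d) ⊆ {p a, p b} ∩ {p c, p d}

/-- A triangulation is an edge-maximal crossing-free geometric graph. -/
def IsTriangulation {m : ℕ} (p : Fin m → ℝ × ℝ) (G : SimpleGraph (Fin m)) : Prop :=
  Maximal (CrossingFree p) G

/-- The number of triangulations of a point set. -/
noncomputable def triangulationCount {m : ℕ} (p : Fin m → ℝ × ℝ) : ℕ :=
  {G : SimpleGraph (Fin m) | IsTriangulation p G}.ncard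

/-! ## Chains -/

/-- The edge between `p i` and `p j` is contained in every triangulation. -/
def IsUnavoidable {m : ℕ} (p : Fin m → ℝ × ℝ) (i j : Fin m) : Prop :=
  ∀ G : SimpleGraph (Fin m), IsTriangulation p G → G.Adj i j

/-- A chain with `n` chain edges: points `p 0, …, p n` in general position, sorted by increasing
`x`-coordinate, such that each edge between consecutive points is unavoidable. -/
structure IsPointChain {n : ℕ} (p : Fin (n + 1) → ℝ × ℝ) : Prop where
  generalPosition : SortedGeneralPosition p
  unavoidable : ∀ i : Fin n, IsUnavoidable p i.castSucc i.succ

/-- Twice the signed area of the triangle `a b c`; positive iff `a`, `b`, `c` are in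
counter-clockwise order. When `a.1 < b.1 < c.1` it is positive iff `b` lies below the segment
from `a` to `c`, and negative iff `b` lies above it. -/
def signedArea (a b c : ℝ × ℝ) : ℝ :=
  (b.1 - a.1) * (c.2 - a.2) - (b.2 - a.2) * (c.1 - a.1)

open Classical in
/-- The visibility triangle: for `i < j` the entry is `0` if `p i`, `p j` span a chain edge,
`+1` if the edge from `p i` to `p j` lies above the chain curve, that is, above all the chain
points in between, and `-1` if it lies below. Entries with `j ≤ i` are not used and are set
to `0`. (For a chain, every edge that is not a chain edge lies either above or below.) -/
noncomputable def visibility {n : ℕ} (p : Fin (n + 1) → ℝ × ℝ) (i j : Fin (n + 1)) : ℤ :=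
  if (j : ℕ) ≤ i + 1 then 0
  else if ∀ k, i < k → k < j → 0 < signedArea (p i) (p k) (p j) then 1
  else if ∀ k, i < k → k < j → signedArea (p i) (p k) (p j) < 0 then -1
  else 0

/-! ## A random access machine with unit-cost integer additions and multiplications

Programs of a small imperative language. The memory consists of integer arrays, indexed by
integers; the names of the arrays are constants in the program text, while the indices are
computed at run time. The only arithmetic operations are addition and multiplication of integers,
and the only test is a comparison with zero. -/

namespace RAM

/-- Contents of the memory: `s a k` is cell `k` of array `a`. -/
abbrev Memory : Type := ℕ → ℤ → ℤ

/-- Integer expressions. -/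
inductive Expr : Type
  | const (z : ℤ)
  | read (a : ℕ) (index : Expr)
  | add (e₁ e₂ : Expr)
  | mul (e₁ e₂ : Expr)

/-- The value of an expression. -/
def Expr.eval (s : Memory) : Expr → ℤ
  | .const z => z
  | .read a i => s a (i.eval s)
  | .add e₁ e₂ => e₁.eval s + e₂.eval s
  | .mul e₁ e₂ => e₁.eval s * e₂.eval s

/-- The number of elementary steps for evaluating an expression: one for every constant,
memory access, addition and multiplication. -/
def Expr.cost : Expr → ℕ
  | .const _ => 1
  | .read _ i => i.cost + 1
  | .add e₁ e₂ => e₁.cost + e₂.cost + 1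
  | .mul e₁ e₂ => e₁.cost + e₂.cost + 1

/-- Programs. -/
inductive Program : Type
  | skip
  /-- store the value of `value` in cell `index` of array `a` -/
  | write (a : ℕ) (index value : Expr)
  | seq (P Q : Program)
  /-- run `P` if the value of `test` is positive, and `Q` otherwise -/
  | ifPos (test : Expr) (P Q : Program)
  /-- run `P` again and again as long as the value of `test` is positive -/
  | whilePos (test : Expr) (P : Program)

/-- The memory after storing `z` in cell `k` of array `a`. -/
def Memory.store (s : Memory) (a : ℕ) (k z : ℤ) : Memory :=
  Function.update s a (Function.update (s a) k z)

/-- `Runs P s t s'`: started with memory `s`, the program `P` halts after exactly `t` elementary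
steps with memory `s'`. Each `skip`, store and test is one step, in addition to the steps for
evaluating the expressions that are involved. -/
inductive Runs : Program → Memory → ℕ → Memory → Prop
  | skip (s : Memory) : Runs .skip s 1 s
  | write (s : Memory) (a : ℕ) (i e : Expr) :
      Runs (.write a i e) s (i.cost + e.cost + 1) (s.store a (i.eval s) (e.eval s))
  | seq {P Q : Program} {s s' s'' : Memory} {t t' : ℕ} :
      Runs P s t s' → Runs Q s' t' s'' → Runs (.seq P Q) s (t + t') s''
  | ifPos_pos {e : Expr} {P Q : Program} {s s' : Memory} {t : ℕ} :
      0 < e.eval s → Runs P s t s' → Runs (.ifPos e P Q) s (e.cost + 1 + t) s'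
  | ifPos_nonpos {e : Expr} {P Q : Program} {s s' : Memory} {t : ℕ} :
      e.eval s ≤ 0 → Runs Q s t s' → Runs (.ifPos e P Q) s (e.cost + 1 + t) s'
  | whilePos_pos {e : Expr} {P : Program} {s s' s'' : Memory} {t t' : ℕ} :
      0 < e.eval s → Runs P s t s' → Runs (.whilePos e P) s' t' s'' →
        Runs (.whilePos e P) s (e.cost + 1 + t + t') s''
  | whilePos_nonpos {e : Expr} {P : Program} {s : Memory} :
      e.eval s ≤ 0 → Runs (.whilePos e P) s (e.cost + 1) s

/-- The initial memory for an `(n + 1) × (n + 1)` integer matrix `V` as input: `n` is in cell `0`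
of array `0`, the entry `V i j` is in cell `i * (n + 1) + j` of array `1`, and all the other
cells are `0`. -/
def inputMemory {n : ℕ} (V : Fin (n + 1) → Fin (n + 1) → ℤ) : Memory
  | 0, k => if k = 0 then n else 0
  | 1, k =>
    if h : 0 ≤ k ∧ k.toNat / (n + 1) < n + 1 then
      V ⟨k.toNat / (n + 1), h.2⟩ ⟨k.toNat % (n + 1), Nat.mod_lt _ n.succ_pos⟩
    else 0
  | _, _ => 0

theorem inputMemory_entry {n : ℕ} (V : Fin (n + 1) → Fin (n + 1) → ℤ) (i j : Fin (n + 1)) :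
    inputMemory V 1 ((i : ℤ) * (n + 1) + j) = V i j := by
  have h0 : ((i : ℤ) * (n + 1) + j) = (((j : ℕ) + (n + 1) * (i : ℕ) : ℕ) : ℤ) := by
    push_cast; ring
  have h1 : ((j : ℕ) + (n + 1) * (i : ℕ)) / (n + 1) = i := by
    rw [Nat.add_mul_div_left _ _ n.succ_pos, Nat.div_eq_of_lt j.isLt, zero_add]
  have h2 : ((j : ℕ) + (n + 1) * (i : ℕ)) % (n + 1) = j := by
    rw [Nat.add_mul_mod_self_left, Nat.mod_eq_of_lt j.isLt]
  rw [h0]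
  simp only [inputMemory, Int.toNat_natCast, h1, h2]
  exact dif_pos ⟨Int.natCast_nonneg _, i.isLt⟩

end RAM

/-! Edges of opposite sign never cross, and two edges of equal sign cross exactly when their index
intervals interleave (`crossingFree_iff`). A triangulation therefore consists of the chain edges, a
maximal noncrossing set of edges of sign `1` and one of sign `-1`, chosen independently, and the
count is a product (`triangulationCount_eq`). It remains to count the maximal sets for one sign `σ`
in quadratic time.

The signs have a recursive structure. Among the points strictly between `p i` and `p j`, let `p h`
have the greatest vertical distance from the segment `p i p j`. Every edge that passes over `h`
inside `[i, j]` then has the sign of `(i, j)` (`visibility_exists_split`). If this sign is not `σ`,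
the two sides of `h` are independent (`maxCount_mul`). If it is `σ`, every edge `(a, b)` over `h`
bounds a triangle with a unique apex `c`, so its weight `w a b`, the number of maximal sets below
it, is `∑ c, w a c * w c b` (`maxCount_eq_sum`).

The individual weights are not tabulated. Each interval of the recursion only records, for every
`k`, the total weight of the paths with `k` edges between its ends. Let `L` and `R` be these numbers
for `[i, h]` and `[h, j]`, and let `D(u, v)` be the total weight of the paths from `i` to `j` with
an edge over `h`, `u` edges before it and `v` after it. Replacing that edge by the other two sides
of its triangle gives `D(u, v) = L(u+1) R(v+1) + D(u+1, v) + D(u, v+1)`, the terms standing for `c =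
h`, `c < h` and `c > h` (`passingWeight_rec`). As `D` vanishes for `u ≥ h - i` and for `v ≥ j - h`,
this determines `D`. Every path visits `h` or passes over it, so the path weights of `[i, j]` follow
(`pathWeight_eq_sum_box`), and `D(0, 0)` is the count for `[i, j]` if `(i, j)` has sign `σ`.

A merge takes `O((h - i)(j - h))` steps, and so does finding `h` by a scan (`isSplit_of_forall_gt`).
Since `(a + b)² = a² + b² + 2ab`, the recursion takes `O(n²)` steps in total; it is run with an
explicit stack (`solve_reaches`). -/

/-! ## Maximal noncrossing sets of edges -/

/-- No two edges of `S`, viewed as intervals, interleave. -/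
def Noncrossing (S : Set (ℕ × ℕ)) : Prop :=
  ∀ e ∈ S, ∀ f ∈ S, ¬ (e.1 < f.1 ∧ f.1 < e.2 ∧ e.2 < f.2)

/-- `S` is a noncrossing set of `R`-edges between `i` and `j`. -/
def Admissible (R : ℕ → ℕ → Prop) (i j : ℕ) (S : Set (ℕ × ℕ)) : Prop :=
  (∀ e ∈ S, R e.1 e.2 ∧ i ≤ e.1 ∧ e.2 ≤ j) ∧ Noncrossing S

/-- The maximal noncrossing sets of `R`-edges between `i` and `j`. -/
def maxNoncrossing (R : ℕ → ℕ → Prop) (i j : ℕ) : Set (Set (ℕ × ℕ)) :=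
  {S | Maximal (Admissible R i j) S}

/-- The number of maximal noncrossing sets of `R`-edges between `i` and `j`. -/
noncomputable def maxCount (R : ℕ → ℕ → Prop) (i j : ℕ) : ℕ := (maxNoncrossing R i j).ncard

/-- Every `R`-edge skips a vertex. -/
def Skips (R : ℕ → ℕ → Prop) : Prop := ∀ a b, R a b → a + 1 < b

/-- All edges that pass over `h` between `i` and `j` are `R`-edges. -/
def IsSplit (R : ℕ → ℕ → Prop) (i h j : ℕ) : Prop :=
  i < h ∧ h < j ∧ ∀ a b, i ≤ a → a < h → h < b → b ≤ j → R a b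

open Classical in
/-- The number of triangulations below the edge from `a` to `b`, where the edge is either an
edge of the chain or an `R`-edge. -/
noncomputable def edgeWeight (R : ℕ → ℕ → Prop) (a b : ℕ) : ℕ :=
  if b = a + 1 ∨ R a b then maxCount R a b else 0

theorem maxNoncrossing_finite (R : ℕ → ℕ → Prop) (i j : ℕ) (hR : Skips R) :
    (maxNoncrossing R i j).Finite := by
  refine ((Set.finite_Iic (j, j)).powerset).subset ?_
  intro S hS e he
  have h := hS.1.1 e he
  have := hR _ _ h.1
  exact ⟨by show e.1 ≤ j; omega, h.2.2⟩

theorem mem_of_maximal {R : ℕ → ℕ → Prop} {i j a b : ℕ} {S : Set (ℕ × ℕ)}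
    (hS : S ∈ maxNoncrossing R i j) (hab : R a b) (ha : i ≤ a) (hb : b ≤ j)
    (h : ∀ e ∈ S, ¬ (e.1 < a ∧ a < e.2 ∧ e.2 < b) ∧ ¬ (a < e.1 ∧ e.1 < b ∧ b < e.2)) :
    (a, b) ∈ S := by
  have hadm : Admissible R i j (insert (a, b) S) := by
    refine ⟨?_, ?_⟩
    · rintro e (rfl | he)
      · exact ⟨hab, ha, hb⟩
      · exact hS.1.1 e he
    · rintro e (rfl | he) f (rfl | hf)
      · rintro ⟨h1, -⟩; exact lt_irrefl _ h1
      · exact (h f hf).2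
      · exact (h e he).1
      · exact hS.1.2 e he f hf
  exact hS.2 hadm (Set.subset_insert _ _) (Set.mem_insert _ _)

theorem top_mem_of_maximal {R : ℕ → ℕ → Prop} {i j : ℕ} {S : Set (ℕ × ℕ)}
    (hS : S ∈ maxNoncrossing R i j) (hij : R i j) : (i, j) ∈ S := by
  refine mem_of_maximal hS hij le_rfl le_rfl fun e he => ?_
  have := hS.1.1 e he
  omega

theorem Admissible.mono {R : ℕ → ℕ → Prop} {i j i' j' : ℕ} {S : Set (ℕ × ℕ)}
    (hS : Admissible R i j S) (hi : i' ≤ i) (hj : j ≤ j') : Admissible R i' j' S :=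
  ⟨fun e he => ⟨(hS.1 e he).1, hi.trans (hS.1 e he).2.1, (hS.1 e he).2.2.trans hj⟩, hS.2⟩

theorem Admissible.restrict {R : ℕ → ℕ → Prop} {i j : ℕ} (i' j' : ℕ) {S : Set (ℕ × ℕ)}
    (hS : Admissible R i j S) : Admissible R i' j' {e ∈ S | i' ≤ e.1 ∧ e.2 ≤ j'} :=
  ⟨fun e he => ⟨(hS.1 e he.1).1, he.2⟩, fun e he f hf => hS.2 e he.1 f hf.1⟩

theorem Admissible.union {R : ℕ → ℕ → Prop} {i h j : ℕ} {S T : Set (ℕ × ℕ)} (hih : i ≤ h)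
    (hhj : h ≤ j) (hS : Admissible R i h S) (hT : Admissible R h j T) :
    Admissible R i j (S ∪ T) := by
  refine ⟨?_, ?_⟩
  · rintro e (he | he)
    · exact (hS.mono le_rfl hhj).1 e he
    · exact (hT.mono hih le_rfl).1 e he
  · rintro e (he | he) f (hf | hf)
    · exact hS.2 e he f hf
    · have := hS.1 e he; have := hT.1 f hf; omega
    · have := hT.1 e he; have := hS.1 f hf; omega
    · exact hT.2 e he f hf

theorem Admissible.insert_top {R : ℕ → ℕ → Prop} {i j : ℕ} {S : Set (ℕ × ℕ)}
    (hS : Admissible R i j S) (hij : R i j) : Admissible R i j (insert (i, j) S) := by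
  refine ⟨?_, ?_⟩
  · rintro e (rfl | he)
    · exact ⟨hij, le_rfl, le_rfl⟩
    · exact hS.1 e he
  · rintro e (rfl | he) f (rfl | hf)
    · simp
    · have := hS.1 f hf; rintro ⟨h1, h2, h3⟩; simp only at *; omega
    · have := hS.1 e he; rintro ⟨h1, h2, h3⟩; simp only at *; omega
    · exact hS.2 e he f hf

/-- By `hout`, the edges of `S` not inside `[a, b]` lie beside this interval or span it, and such
edges never interleave with an edge inside. Whatever can be added to the restriction can thus be
added to `S`. -/
theorem restrict_maximal {R : ℕ → ℕ → Prop} {i j a b : ℕ} {S : Set (ℕ × ℕ)}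
    (hS : S ∈ maxNoncrossing R i j) (ha : i ≤ a) (hb : b ≤ j)
    (hout : ∀ e ∈ S, (a ≤ e.1 ∧ e.2 ≤ b) ∨ e.2 ≤ a ∨ b ≤ e.1 ∨ (e.1 ≤ a ∧ b ≤ e.2)) :
    {e ∈ S | a ≤ e.1 ∧ e.2 ≤ b} ∈ maxNoncrossing R a b := by
  refine ⟨hS.1.restrict a b, ?_⟩
  intro T hT hle f hf
  have hf' := hT.1 f hf
  refine ⟨mem_of_maximal hS hf'.1 (ha.trans hf'.2.1) (hf'.2.2.trans hb) fun e he => ?_, hf'.2⟩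
  rcases hout e he with h | h
  · have heT : e ∈ T := hle ⟨he, h⟩
    exact ⟨hT.2 e heT f hf, hT.2 f hf e heT⟩
  · omega

theorem maxCount_succ {R : ℕ → ℕ → Prop} (hR : Skips R) (i : ℕ) : maxCount R i (i + 1) = 1 := by
  have h0 : ∀ S, Admissible R i (i + 1) S → S = ∅ := by
    intro S hS
    refine Set.eq_empty_of_forall_notMem fun e he => ?_
    have := hS.1 e he
    have := hR _ _ this.1
    omega
  have : maxNoncrossing R i (i + 1) = {∅} := by
    ext S
    constructor
    · intro hS; exact h0 S hS.1
    · rintro rfl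
      refine ⟨⟨by simp, by simp [Noncrossing]⟩, fun T hT _ => ?_⟩
      rw [h0 T hT]
  rw [maxCount, this, Set.ncard_singleton]

theorem maxCount_mul {R : ℕ → ℕ → Prop} {i h j : ℕ} (hih : i ≤ h) (hhj : h ≤ j)
    (hR : Skips R) (hno : ∀ a b, i ≤ a → a < h → h < b → b ≤ j → ¬ R a b) :
    maxCount R i j = maxCount R i h * maxCount R h j := by
  have key : ∀ S, Admissible R i j S → ∀ e ∈ S, e.2 ≤ h ∨ h ≤ e.1 := by
    intro S hS e he
    have h1 := hS.1 e he
    by_contra hc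
    push Not at hc
    exact hno e.1 e.2 h1.2.1 hc.2 hc.1 h1.2.2 h1.1
  have himg : maxNoncrossing R i j =
      (fun q : Set (ℕ × ℕ) × Set (ℕ × ℕ) => q.1 ∪ q.2) ''
        (maxNoncrossing R i h ×ˢ maxNoncrossing R h j) := by
    ext S
    constructor
    · intro hS
      refine ⟨({e ∈ S | i ≤ e.1 ∧ e.2 ≤ h}, {e ∈ S | h ≤ e.1 ∧ e.2 ≤ j}),
        ⟨restrict_maximal hS le_rfl hhj ?_, restrict_maximal hS hih le_rfl ?_⟩, ?_⟩
      · intro e he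
        have := key S hS.1 e he; have := hS.1.1 e he; omega
      · intro e he
        have := key S hS.1 e he; have := hS.1.1 e he; omega
      · ext e
        simp only [Set.mem_union, Set.mem_ofPred_eq]
        constructor
        · rintro (h | h) <;> exact h.1
        · intro he
          have := key S hS.1 e he; have h2 := hS.1.1 e he
          rcases this with h | h
          · exact Or.inl ⟨he, h2.2.1, h⟩
          · exact Or.inr ⟨he, h, h2.2.2⟩
    · rintro ⟨⟨A, B⟩, ⟨hA, hB⟩, rfl⟩
      refine ⟨hA.1.union hih hhj hB.1, ?_⟩
      intro T hT hle e he
      have h2 := hT.1 e he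
      rcases key T hT e he with h | h
      · left
        refine mem_of_maximal hA h2.1 h2.2.1 h fun f hf => ?_
        have hf' := hle (Or.inl hf)
        exact ⟨hT.2 f hf' e he, hT.2 e he f hf'⟩
      · right
        refine mem_of_maximal hB h2.1 h h2.2.2 fun f hf => ?_
        have hf' := hle (Or.inr hf)
        exact ⟨hT.2 f hf' e he, hT.2 e he f hf'⟩
  have hinj : Set.InjOn (fun q : Set (ℕ × ℕ) × Set (ℕ × ℕ) => q.1 ∪ q.2)
      (maxNoncrossing R i h ×ˢ maxNoncrossing R h j) := by
    rintro ⟨A, B⟩ ⟨hA, hB⟩ ⟨A', B'⟩ ⟨hA', hB'⟩ heq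
    simp only at heq hA hB hA' hB'
    -- The two parts can be read off from their union: a common edge would begin and end at `h`, but
    -- every edge skips a vertex.
    have hAB : ∀ e ∈ A, ∀ X ∈ maxNoncrossing R h j, e ∉ X := by
      intro e he X hX heX
      have h1 := hA.1.1 e he; have h2 := hX.1.1 e heX; have := hR _ _ h1.1; omega
    have hAB' : ∀ e ∈ A', ∀ X ∈ maxNoncrossing R h j, e ∉ X := by
      intro e he X hX heX
      have h1 := hA'.1.1 e he; have h2 := hX.1.1 e heX; have := hR _ _ h1.1; omega
    have h1 : ∀ e, (e ∈ A ∨ e ∈ B) ↔ (e ∈ A' ∨ e ∈ B') := fun e => by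
      rw [← Set.mem_union, ← Set.mem_union, heq]
    refine Prod.ext (Set.ext fun e => ?_) (Set.ext fun e => ?_)
    · have := h1 e; have := hAB e; have := hAB' e
      simp only; grind
    · have := h1 e; have := hAB e; have := hAB' e
      simp only; grind
  rw [maxCount, himg, hinj.ncard_image, Set.ncard_prod]
  rfl

/-- `c` is the apex of the triangle below the edge from `i` to `j`. -/
def IsApex (S : Set (ℕ × ℕ)) (i c j : ℕ) : Prop :=
  i < c ∧ c < j ∧ (c = i + 1 ∨ (i, c) ∈ S) ∧ (j = c + 1 ∨ (c, j) ∈ S)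

/-- The apex is the last vertex `c < j` joined to `i`. Were `c` not joined to `j`, maximality of `S`
would be violated by `(c, j)` if `c < h`, and by an edge `(i, d)` with `d > c` if `h ≤ c`. Either
edge passes over `h`, hence is available because of the split. -/
theorem exists_apex {R : ℕ → ℕ → Prop} {i h j : ℕ} (hsp : IsSplit R i h j)
    {S : Set (ℕ × ℕ)} (hS : S ∈ maxNoncrossing R i j) : ∃ c, IsApex S i c j := by
  classical
  obtain ⟨hih, hhj, hall⟩ := hsp
  let p : ℕ → Prop := fun c => i < c ∧ c < j ∧ (c = i + 1 ∨ (i, c) ∈ S)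
  have hp1 : p (i + 1) := ⟨by omega, by omega, Or.inl rfl⟩
  obtain ⟨c, ⟨hic, hcj, hc⟩, hmax⟩ : ∃ c, p c ∧ ∀ c', p c' → c' ≤ c := by
    refine ⟨Nat.findGreatest p j, Nat.findGreatest_spec (by omega) hp1, fun c' hc' => ?_⟩
    exact Nat.le_findGreatest (by have := hc'.2.1; omega) hc'
  have hleft : ∀ e ∈ S, e.1 < c → c < e.2 → e.2 < j → False := by
    intro e he h1 h2 h3
    have he' := hS.1.1 e he
    rcases Nat.lt_or_ge i e.1 with hi | hi
    · rcases hc with hc | hc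
      · omega
      · exact hS.1.2 _ hc _ he ⟨hi, h1, h2⟩
    · have hie : e.1 = i := by omega
      have := hmax e.2 ⟨by omega, h3, Or.inr (by rw [← hie]; exact he)⟩
      omega
  refine ⟨c, hic, hcj, hc, ?_⟩
  by_contra hcon
  push Not at hcon
  obtain ⟨hj1, hcjS⟩ := hcon
  rcases Nat.lt_or_ge c h with hch | hch
  · refine hcjS (mem_of_maximal hS (hall c j hic.le hch hhj le_rfl) hic.le le_rfl fun e he => ?_)
    have he' := hS.1.1 e he
    refine ⟨fun h' => hleft e he h'.1 h'.2.1 h'.2.2, by omega⟩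
  -- Here `(c, j)` need not be an `R`-edge. With `d` the last neighbor of `c` before `j`, the edge
  -- `(i, d)` closes the triangle `i, c, d` and contradicts the choice of `c`.
  · let r : ℕ → Prop := fun d => c < d ∧ d < j ∧ (d = c + 1 ∨ (c, d) ∈ S)
    have hr1 : r (c + 1) := ⟨by omega, by omega, Or.inl rfl⟩
    obtain ⟨d, ⟨hcd, hdj, hd⟩, hdmax⟩ : ∃ c, r c ∧ ∀ c', r c' → c' ≤ c := by
      refine ⟨Nat.findGreatest r j, Nat.findGreatest_spec (by omega) hr1, fun c' hc' => ?_⟩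
      exact Nat.le_findGreatest (by have := hc'.2.1; omega) hc'
    have hid : (i, d) ∈ S := by
      refine mem_of_maximal hS (hall i d le_rfl hih (by omega) hdj.le) le_rfl hdj.le
        fun e he => ?_
      have he' := hS.1.1 e he
      refine ⟨by omega, ?_⟩
      rintro ⟨h1, h2, h3⟩
      rcases lt_trichotomy e.1 c with h4 | h4 | h4
      · rcases hc with hc | hc
        · omega
        · exact hS.1.2 _ hc _ he ⟨h1, h4, by simp only; omega⟩
      · rcases Nat.lt_or_ge e.2 j with h5 | h5
        · have := hdmax e.2 ⟨by omega, h5, Or.inr (by rw [← h4]; exact he)⟩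
          omega
        · have : e.2 = j := by omega
          exact hcjS (by rw [← h4, ← this]; exact he)
      · rcases hd with hd | hd
        · omega
        · exact hS.1.2 _ hd _ he ⟨h4, h2, h3⟩
    have := hmax d ⟨by omega, hdj, Or.inr hid⟩
    omega

/-- For apexes `c < d`, the sides `(i, d)` and `(c, j)` interleave; neither can be a chain edge. -/
theorem IsApex.unique {R : ℕ → ℕ → Prop} {i j c d : ℕ} {S : Set (ℕ × ℕ)}
    (hS : Admissible R i j S) (hc : IsApex S i c j) (hd : IsApex S i d j) : c = d := by
  have aux : ∀ c d, IsApex S i c j → IsApex S i d j → ¬ c < d := by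
    rintro c d ⟨h1, h2, h3, h4⟩ ⟨h5, h6, h7, h8⟩ hlt
    rcases h4 with h4 | h4
    · omega
    rcases h7 with h7 | h7
    · omega
    exact hS.2 _ h7 _ h4 ⟨h1, hlt, h6⟩
  have := aux c d hc hd
  have := aux d c hd hc
  omega

/-- An edge over the apex other than `(i, j)` would interleave with one of the two sides `(i, c)`
and `(c, j)`. -/
theorem IsApex.cases {R : ℕ → ℕ → Prop} {i j c : ℕ} {S : Set (ℕ × ℕ)} (hR : Skips R)
    (hS : Admissible R i j S) (hc : IsApex S i c j) {e : ℕ × ℕ} (he : e ∈ S) :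
    e.2 ≤ c ∨ c ≤ e.1 ∨ e = (i, j) := by
  obtain ⟨h1, h2, h3, h4⟩ := hc
  have h5 := hS.1 e he
  have h6 := hR _ _ h5.1
  by_contra hcon
  push Not at hcon
  obtain ⟨h7, h8, h9⟩ := hcon
  rcases Nat.lt_or_ge i e.1 with hi | hi
  · rcases h3 with h3 | h3
    · omega
    · exact hS.2 _ h3 _ he ⟨hi, h8, h7⟩
  · have h10 : e.1 = i := by omega
    have h11 : e.2 ≠ j := fun h => h9 (Prod.ext h10 h)
    rcases h4 with h4 | h4
    · omega
    · exact hS.2 _ he _ h4 ⟨by simp only; omega, h7, by simp only; omega⟩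

/-- Below `(i, j)`, the triangle with apex `c` leaves two independent subproblems. If one of its
sides is neither a chain edge nor an `R`-edge, `edgeWeight` makes the product `0`, as it should be.
-/
theorem ncard_apex {R : ℕ → ℕ → Prop} {i j c : ℕ} (hR : Skips R) (hij : R i j)
    (hic : i < c) (hcj : c < j) :
    {S ∈ maxNoncrossing R i j | IsApex S i c j}.ncard = edgeWeight R i c * edgeWeight R c j := by
  classical
  by_cases hv : (c = i + 1 ∨ R i c) ∧ (j = c + 1 ∨ R c j)
  swap
  · have : {S ∈ maxNoncrossing R i j | IsApex S i c j} = ∅ := by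
      refine Set.eq_empty_of_forall_notMem ?_
      rintro S ⟨hS, h1, h2, h3, h4⟩
      exact hv ⟨h3.imp_right fun h => (hS.1.1 _ h).1, h4.imp_right fun h => (hS.1.1 _ h).1⟩
    rw [this, Set.ncard_empty, edgeWeight, edgeWeight]
    by_cases h1 : (c = i + 1 ∨ R i c)
    · rw [if_neg (fun h => hv ⟨h1, h⟩), mul_zero]
    · rw [if_neg h1, zero_mul]
  rw [edgeWeight, edgeWeight, if_pos hv.1, if_pos hv.2]
  have himg : {S ∈ maxNoncrossing R i j | IsApex S i c j} =
      (fun q : Set (ℕ × ℕ) × Set (ℕ × ℕ) => insert (i, j) (q.1 ∪ q.2)) ''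
        (maxNoncrossing R i c ×ˢ maxNoncrossing R c j) := by
    ext S
    constructor
    · rintro ⟨hS, hap⟩
      refine ⟨({e ∈ S | i ≤ e.1 ∧ e.2 ≤ c}, {e ∈ S | c ≤ e.1 ∧ e.2 ≤ j}),
        ⟨restrict_maximal hS le_rfl hcj.le ?_, restrict_maximal hS hic.le le_rfl ?_⟩, ?_⟩
      · intro e he
        have h2 := hS.1.1 e he
        rcases hap.cases hR hS.1 he with h | h | h
        · omega
        · omega
        · rw [h]; simp only; omega
      · intro e he
        have h2 := hS.1.1 e he
        rcases hap.cases hR hS.1 he with h | h | h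
        · omega
        · omega
        · rw [h]; simp only; omega
      · ext e
        simp only [Set.mem_insert_iff, Set.mem_union, Set.mem_ofPred_eq]
        constructor
        · rintro (rfl | h | h)
          · exact top_mem_of_maximal hS hij
          · exact h.1
          · exact h.1
        · intro he
          have h2 := hS.1.1 e he
          rcases hap.cases hR hS.1 he with h | h | h
          · exact Or.inr (Or.inl ⟨he, h2.2.1, h⟩)
          · exact Or.inr (Or.inr ⟨he, h, h2.2.2⟩)
          · exact Or.inl h
    · rintro ⟨⟨A, B⟩, ⟨hA, hB⟩, rfl⟩
      have hadm := (hA.1.union hic.le hcj.le hB.1).insert_top hij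
      have hap : IsApex (insert (i, j) (A ∪ B)) i c j :=
        ⟨hic, hcj, hv.1.imp_right fun h => Or.inr (Or.inl (top_mem_of_maximal hA h)),
          hv.2.imp_right fun h => Or.inr (Or.inr (top_mem_of_maximal hB h))⟩
      refine ⟨⟨hadm, ?_⟩, hap⟩
      intro T hT hle e he
      have hapT : IsApex T i c j :=
        ⟨hic, hcj, hap.2.2.1.imp_right fun h => hle h, hap.2.2.2.imp_right fun h => hle h⟩
      have h2 := hT.1 e he
      rcases hapT.cases hR hT he with h | h | h
      · right; left
        refine mem_of_maximal hA h2.1 h2.2.1 h fun f hf => ?_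
        have hf' := hle (Or.inr (Or.inl hf))
        exact ⟨hT.2 f hf' e he, hT.2 e he f hf'⟩
      · right; right
        refine mem_of_maximal hB h2.1 h h2.2.2 fun f hf => ?_
        have hf' := hle (Or.inr (Or.inr hf))
        exact ⟨hT.2 f hf' e he, hT.2 e he f hf'⟩
      · left; exact h
  have hinj : Set.InjOn (fun q : Set (ℕ × ℕ) × Set (ℕ × ℕ) => insert (i, j) (q.1 ∪ q.2))
      (maxNoncrossing R i c ×ˢ maxNoncrossing R c j) := by
    have hl : ∀ X ∈ maxNoncrossing R i c, ∀ Y ∈ maxNoncrossing R c j,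
        X = {e ∈ insert (i, j) (X ∪ Y) | e.2 ≤ c} ∧
        Y = {e ∈ insert (i, j) (X ∪ Y) | c ≤ e.1} := by
      intro X hX Y hY
      constructor
      · ext e
        simp only [Set.mem_ofPred_eq, Set.mem_insert_iff, Set.mem_union]
        constructor
        · intro he; exact ⟨Or.inr (Or.inl he), (hX.1.1 e he).2.2⟩
        · rintro ⟨rfl | he | he, h⟩
          · simp only at h; omega
          · exact he
          · have h1 := hY.1.1 e he
            have := hR _ _ h1.1
            omega
      · ext e
        simp only [Set.mem_ofPred_eq, Set.mem_insert_iff, Set.mem_union]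
        constructor
        · intro he; exact ⟨Or.inr (Or.inr he), (hY.1.1 e he).2.1⟩
        · rintro ⟨rfl | he | he, h⟩
          · simp only at h; omega
          · have h1 := hX.1.1 e he
            have := hR _ _ h1.1
            omega
          · exact he
    rintro ⟨A, B⟩ ⟨hA, hB⟩ ⟨A', B'⟩ ⟨hA', hB'⟩ heq
    simp only at heq hA hB hA' hB'
    have h1 := hl A hA B hB
    have h2 := hl A' hA' B' hB'
    rw [heq] at h1
    exact Prod.ext (h1.1.trans h2.1.symm) (h1.2.trans h2.2.symm)
  rw [himg, hinj.ncard_image, Set.ncard_prod]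
  rfl

theorem maxCount_eq_sum {R : ℕ → ℕ → Prop} {i h j : ℕ} (hR : Skips R) (hsp : IsSplit R i h j) :
    maxCount R i j = ∑ c ∈ Finset.Ioo i j, edgeWeight R i c * edgeWeight R c j := by
  classical
  have hij : R i j := hsp.2.2 i j le_rfl hsp.1 hsp.2.1 le_rfl
  have hfin := maxNoncrossing_finite R i j hR
  -- The default `0` never occurs on maximal sets, by `exists_apex`.
  let ap : Set (ℕ × ℕ) → ℕ := fun S => if h : ∃ c, IsApex S i c j then h.choose else 0
  have hap : ∀ S ∈ maxNoncrossing R i j, ∀ c, ap S = c ↔ IsApex S i c j := by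
    intro S hS c
    have h := exists_apex hsp hS
    have h1 : IsApex S i (ap S) j := by
      simp only [ap, dif_pos h]; exact h.choose_spec
    constructor
    · rintro rfl; exact h1
    · intro h2; exact h1.unique hS.1 h2
  rw [maxCount, Set.ncard_eq_toFinset_card _ hfin,
    Finset.card_eq_sum_card_fiberwise (f := ap) (t := Finset.Ioo i j)]
  · refine Finset.sum_congr rfl fun c hc => ?_
    rw [Finset.mem_Ioo] at hc
    rw [← ncard_apex hR hij hc.1 hc.2, ← Set.ncard_coe_finset]
    congr 1
    ext S
    simp only [Finset.coe_filter, Set.Finite.mem_toFinset, Set.mem_ofPred_eq]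
    constructor
    · rintro ⟨h1, h2⟩; exact ⟨h1, (hap S h1 c).1 h2⟩
    · rintro ⟨h1, h2⟩; exact ⟨h1, (hap S h1 c).2 h2⟩
  · intro S hS
    simp only [Set.Finite.coe_toFinset] at hS
    have h1 := (hap S hS _).1 rfl
    simp only [Finset.coe_Ioo, Set.mem_Ioo]
    exact ⟨h1.1, h1.2.1⟩

/-! ## Weighted paths -/

/-- The total weight of the paths with `k` edges from `i` to `j` inside `{0, …, N - 1}`. -/
def pathWeight (N : ℕ) (w : ℕ → ℕ → ℕ) : ℕ → ℕ → ℕ → ℕ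
  | 0, i, j => if i = j then 1 else 0
  | k + 1, i, j => ∑ c ∈ Finset.range N, w i c * pathWeight N w k c j

/-- The total weight of the paths from `i` to `j` that have an edge passing over `h`, with `u`
edges before that edge and `v` edges after it. -/
def passingWeight (N : ℕ) (w : ℕ → ℕ → ℕ) (h j : ℕ) (u v i : ℕ) : ℕ :=
  ∑ a ∈ Finset.range h, ∑ b ∈ Finset.Ico (h + 1) N,
    pathWeight N w u i a * w a b * pathWeight N w v b j

section Paths

variable {N : ℕ} {w : ℕ → ℕ → ℕ}

/-- Edges of nonzero weight go to the right, so `k` of them advance by at least `k`. -/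
theorem pathWeight_eq_zero (hw : ∀ a b, b ≤ a → w a b = 0) {k i j : ℕ} (h : j < i + k) :
    pathWeight N w k i j = 0 := by
  induction k generalizing i with
  | zero => simp only [pathWeight]; rw [if_neg (by omega)]
  | succ k ih =>
    simp only [pathWeight]
    refine Finset.sum_eq_zero fun c _ => ?_
    rcases Nat.lt_or_ge i c with hc | hc
    · rw [ih (by omega), mul_zero]
    · rw [hw _ _ hc, zero_mul]

theorem pathWeight_succ_right {k i j : ℕ} (hi : i < N) (hj : j < N) :
    pathWeight N w (k + 1) i j = ∑ c ∈ Finset.range N, pathWeight N w k i c * w c j := by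
  induction k generalizing i with
  | zero => simp [pathWeight, hi, hj]
  | succ k ih =>
    rw [pathWeight]
    have : ∀ c ∈ Finset.range N, w i c * pathWeight N w (k + 1) c j =
        ∑ d ∈ Finset.range N, w i c * (pathWeight N w k c d * w d j) := by
      intro c hc
      rw [ih (Finset.mem_range.1 hc), Finset.mul_sum]
    rw [Finset.sum_congr rfl this, Finset.sum_comm]
    refine Finset.sum_congr rfl fun d _ => ?_
    rw [pathWeight, Finset.sum_mul]
    exact Finset.sum_congr rfl fun c _ => (mul_assoc _ _ _).symm

theorem sum_range_split {h : ℕ} (hh : h < N) (f : ℕ → ℕ) :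
    ∑ c ∈ Finset.range N, f c =
      ∑ c ∈ Finset.range h, f c + f h + ∑ c ∈ Finset.Ico (h + 1) N, f c := by
  rw [← Finset.sum_range_succ, Finset.sum_range_add_sum_Ico _ hh]

theorem passingWeight_eq_zero (hw : ∀ a b, b ≤ a → w a b = 0) {h j u v i : ℕ}
    (huv : h ≤ i + u ∨ j ≤ h + v) : passingWeight N w h j u v i = 0 := by
  refine Finset.sum_eq_zero fun a ha => Finset.sum_eq_zero fun b hb => ?_
  rw [Finset.mem_range] at ha
  rw [Finset.mem_Ico] at hb
  rcases huv with huv | huv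
  · rw [pathWeight_eq_zero hw (k := u) (by omega), zero_mul, zero_mul]
  · rw [pathWeight_eq_zero hw (k := v) (by omega), mul_zero]

/-- The weight of the edge over `h` is expanded as a sum over the apex `c`. For `c = h` both
neighboring subpaths end at `h`; for `c < h` the edge `(c, b)` now passes over `h`, and for `c > h`
it is `(a, c)`. -/
theorem passingWeight_rec (hw : ∀ a b, b ≤ a → w a b = 0) {i h j : ℕ} (hi : i < N) (hh : h < N)
    (hsplit : ∀ a b, i ≤ a → a < h → h < b → b ≤ j →
      w a b = ∑ c ∈ Finset.range N, w a c * w c b) (u v : ℕ) :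
    passingWeight N w h j u v i =
      pathWeight N w (u + 1) i h * pathWeight N w (v + 1) h j +
        passingWeight N w h j (u + 1) v i + passingWeight N w h j u (v + 1) i := by
  have hA : ∀ c, c ≤ h → ∑ a ∈ Finset.range h, pathWeight N w u i a * w a c =
      pathWeight N w (u + 1) i c := by
    intro c hc
    rw [pathWeight_succ_right hi (by omega)]
    refine Finset.sum_subset (Finset.range_mono hh.le) fun a _ ha => ?_
    rw [Finset.mem_range] at ha
    rw [hw a c (by omega), mul_zero]
  have hB : ∀ c, h ≤ c → ∑ b ∈ Finset.Ico (h + 1) N, w c b * pathWeight N w v b j =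
      pathWeight N w (v + 1) c j := by
    intro c hc
    rw [pathWeight, Finset.range_eq_Ico]
    refine Finset.sum_subset (Finset.Ico_subset_Ico_left (Nat.zero_le _)) fun b hb hb' => ?_
    rw [Finset.mem_Ico] at hb hb'
    rw [hw c b (by omega), zero_mul]
  have h1 : passingWeight N w h j u v i =
      ∑ c ∈ Finset.range N, (∑ a ∈ Finset.range h, pathWeight N w u i a * w a c) *
        ∑ b ∈ Finset.Ico (h + 1) N, w c b * pathWeight N w v b j := by
    simp_rw [Finset.sum_mul_sum]
    rw [Finset.sum_comm, passingWeight]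
    refine Finset.sum_congr rfl fun a ha => ?_
    rw [Finset.sum_comm]
    refine Finset.sum_congr rfl fun b hb => ?_
    rw [Finset.mem_range] at ha
    rw [Finset.mem_Ico] at hb
    -- `hsplit` is only available inside `[i, j]`; outside, a path weight vanishes.
    by_cases hia : i ≤ a
    · by_cases hbj : b ≤ j
      · rw [hsplit a b hia ha hb.1 hbj, Finset.mul_sum, Finset.sum_mul]
        exact Finset.sum_congr rfl fun c _ => by ring
      · simp [pathWeight_eq_zero hw (k := v) (i := b) (j := j) (by omega)]
    · simp [pathWeight_eq_zero hw (k := u) (i := i) (j := a) (by omega)]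
  rw [h1, sum_range_split hh, hA h le_rfl, hB h le_rfl]
  have h2 : ∑ c ∈ Finset.range h, (∑ a ∈ Finset.range h, pathWeight N w u i a * w a c) *
        ∑ b ∈ Finset.Ico (h + 1) N, w c b * pathWeight N w v b j =
      passingWeight N w h j (u + 1) v i := by
    refine Finset.sum_congr rfl fun c hc => ?_
    rw [hA c (Finset.mem_range.1 hc).le, Finset.mul_sum]
    exact Finset.sum_congr rfl fun b _ => (mul_assoc _ _ _).symm
  have h3 : ∑ c ∈ Finset.Ico (h + 1) N, (∑ a ∈ Finset.range h, pathWeight N w u i a * w a c) *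
        ∑ b ∈ Finset.Ico (h + 1) N, w c b * pathWeight N w v b j =
      passingWeight N w h j u (v + 1) i := by
    rw [passingWeight, Finset.sum_comm]
    refine Finset.sum_congr rfl fun c hc => ?_
    rw [hB c (by have := (Finset.mem_Ico.1 hc).1; omega), Finset.sum_mul]
  rw [h2, h3]
  ring

theorem passingWeight_zero_left {i h j v : ℕ} (hih : i < h) :
    passingWeight N w h j 0 v i =
      ∑ b ∈ Finset.Ico (h + 1) N, w i b * pathWeight N w v b j := by
  rw [passingWeight, Finset.sum_eq_single_of_mem i (Finset.mem_range.2 hih)]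
  · simp [pathWeight]
  · intro a _ ha
    simp [pathWeight, ha.symm]

theorem passingWeight_succ_left {i h j u v : ℕ} :
    passingWeight N w h j (u + 1) v i =
      ∑ c ∈ Finset.range N, w i c * passingWeight N w h j u v c := by
  simp only [passingWeight, pathWeight, Finset.mul_sum, Finset.sum_mul]
  have h1 : ∀ a ∈ Finset.range h, ∑ b ∈ Finset.Ico (h + 1) N, ∑ c ∈ Finset.range N,
      w i c * pathWeight N w u c a * w a b * pathWeight N w v b j =
      ∑ c ∈ Finset.range N, ∑ b ∈ Finset.Ico (h + 1) N,
        w i c * (pathWeight N w u c a * w a b * pathWeight N w v b j) := fun a _ => by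
    rw [Finset.sum_comm]
    exact Finset.sum_congr rfl fun c _ => Finset.sum_congr rfl fun b _ => by ring
  rw [Finset.sum_congr rfl h1, Finset.sum_comm]

open Finset.HasAntidiagonal in
/-- Paths from `i` to `j` either visit `h` or pass over it. -/
theorem pathWeight_eq_sum_antidiagonal (hw : ∀ a b, b ≤ a → w a b = 0) {i h j : ℕ} (hih : i < h)
    (hhj : h < j) (hj : j < N) (r : ℕ) :
    pathWeight N w (r + 1) i j =
      ∑ x ∈ antidiagonal (r + 1), pathWeight N w x.1 i h * pathWeight N w x.2 h j +
        ∑ x ∈ antidiagonal r, passingWeight N w h j x.1 x.2 i := by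
  have hS : ∀ i r, ∑ x ∈ antidiagonal (r + 1),
      pathWeight N w x.1 i h * pathWeight N w x.2 h j =
      pathWeight N w 0 i h * pathWeight N w (r + 1) h j + ∑ c ∈ Finset.range N, w i c *
        ∑ x ∈ antidiagonal r, pathWeight N w x.1 c h * pathWeight N w x.2 h j := by
    intro i r
    rw [Finset.Nat.sum_antidiagonal_succ]
    congr 1
    simp only [pathWeight, Finset.sum_mul, Finset.mul_sum, mul_assoc]
    exact Finset.sum_comm
  have hS_h : ∀ r, ∑ x ∈ antidiagonal r,
      pathWeight N w x.1 h h * pathWeight N w x.2 h j = pathWeight N w r h j := by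
    intro r
    rw [Finset.sum_eq_single_of_mem (0, r) (by simp)]
    · simp [pathWeight]
    · rintro ⟨u, v⟩ hx hne
      rw [mem_antidiagonal] at hx
      simp only at hx
      have : u ≠ 0 := by rintro rfl; exact hne (by simp_all)
      rw [pathWeight_eq_zero hw (k := u) (by omega), zero_mul]
  have hS_gt : ∀ c r, h < c → ∑ x ∈ antidiagonal r,
      pathWeight N w x.1 c h * pathWeight N w x.2 h j = 0 := by
    intro c r hc
    refine Finset.sum_eq_zero fun x _ => ?_
    rw [pathWeight_eq_zero hw (k := x.1) (by omega), zero_mul]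
  have h0 : ∀ {i j}, i < j → pathWeight N w 0 i j = 0 := fun hi => if_neg hi.ne
  -- The weight of the paths with `r` edges that pass over `h`. It is `0` for `r = 0`, since the
  -- passing edge itself counts; this gives one recursion for all `r`.
  let G : ℕ → ℕ → ℕ := fun r c => match r with
    | 0 => 0
    | r + 1 => ∑ x ∈ antidiagonal r, passingWeight N w h j x.1 x.2 c
  have hG_ge : ∀ c r, h ≤ c → G r c = 0 := by
    intro c r hc
    cases r with
    | zero => rfl
    | succ r => exact Finset.sum_eq_zero fun x _ => passingWeight_eq_zero hw (by omega)
  have hG : ∀ i r, G (r + 1) i = passingWeight N w h j 0 r i +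
      ∑ c ∈ Finset.range N, w i c * G r c := by
    intro i r
    cases r with
    | zero => simp [G]
    | succ r =>
      simp only [G]
      rw [Finset.Nat.sum_antidiagonal_succ]
      congr 1
      simp only [passingWeight_succ_left, Finset.mul_sum]
      exact Finset.sum_comm
  -- Induction by removing the first edge, which ends before `h`, at `h`, or beyond `h`.
  have main : ∀ r i, i < h → pathWeight N w r i j =
      ∑ x ∈ antidiagonal r, pathWeight N w x.1 i h * pathWeight N w x.2 h j + G r i := by
    intro r
    induction r with
    | zero =>
      intro i hi
      simp [h0 (hi.trans hhj), h0 hi, G]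
    | succ r ih =>
      intro i hi
      rw [hS, h0 hi, zero_mul, zero_add, hG, passingWeight_zero_left hi, add_left_comm,
        ← Finset.sum_add_distrib, pathWeight]
      simp only [← mul_add]
      rw [sum_range_split (hhj.trans hj), sum_range_split (hhj.trans hj), add_comm]
      congr 1
      have hz : ∑ c ∈ Finset.Ico (h + 1) N, w i c *
          (∑ x ∈ antidiagonal r, pathWeight N w x.1 c h * pathWeight N w x.2 h j + G r c) = 0 := by
        refine Finset.sum_eq_zero fun c hc => ?_
        have := (Finset.mem_Ico.1 hc).1
        rw [hS_gt c r this, hG_ge c r (by omega), add_zero, mul_zero]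
      rw [hz, add_zero, hS_h, hG_ge h r le_rfl, add_zero]
      congr 1
      exact Finset.sum_congr rfl fun c hc => by rw [ih c (Finset.mem_range.1 hc)]
  exact main (r + 1) i hih

open Finset.HasAntidiagonal in
theorem sum_antidiagonal_eq_sum_box (f : ℕ → ℕ → ℕ) (p q r : ℕ)
    (hf : ∀ u v, p ≤ u ∨ q ≤ v → f u v = 0) :
    ∑ x ∈ antidiagonal r, f x.1 x.2 =
      ∑ u ∈ Finset.range p, ∑ v ∈ Finset.range q, if u + v = r then f u v else 0 := by
  rw [← Finset.sum_product', ← Finset.sum_filter]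
  symm
  refine Finset.sum_subset (fun x hx => ?_) fun x hx hx' => hf _ _ ?_
  · exact mem_antidiagonal.2 (Finset.mem_filter.1 hx).2
  · rw [mem_antidiagonal] at hx
    by_contra hcon
    push Not at hcon
    exact hx' (Finset.mem_filter.2 ⟨Finset.mem_product.2
      ⟨Finset.mem_range.2 hcon.1, Finset.mem_range.2 hcon.2⟩, hx⟩)

open Finset.HasAntidiagonal in
-- The form that suits the loops of a merge: each pair `(u, v)` of the box is treated once, and
-- contributes to just two path lengths.
theorem pathWeight_eq_sum_box (hw : ∀ a b, b ≤ a → w a b = 0) {i h j : ℕ} (hih : i < h)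
    (hhj : h < j) (hj : j < N) {r : ℕ} (hr : 1 ≤ r) :
    pathWeight N w r i j =
      ∑ u ∈ Finset.range (h - i), ∑ v ∈ Finset.range (j - h),
        ((if u + v + 2 = r then pathWeight N w (u + 1) i h * pathWeight N w (v + 1) h j else 0) +
          if u + v + 1 = r then passingWeight N w h j u v i else 0) := by
  obtain ⟨r, rfl⟩ : ∃ r', r = r' + 1 := ⟨r - 1, by omega⟩
  have h0 : ∀ {i j}, i < j → pathWeight N w 0 i j = 0 := fun hi => if_neg hi.ne
  rw [pathWeight_eq_sum_antidiagonal hw hih hhj hj]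
  simp only [Finset.sum_add_distrib]
  congr 1
  · cases r with
    | zero =>
      have : ∀ u v, ¬ (u + v + 2 = 1) := by omega
      simp [Finset.Nat.antidiagonal_succ, h0 hih, h0 hhj, this]
    | succ r =>
      -- The two extreme terms vanish because no path without edges leads from `i` to `h` or from
      -- `h` to `j`; hence the shift by `2`.
      rw [Finset.Nat.sum_antidiagonal_succ, Finset.Nat.sum_antidiagonal_succ', h0 hih, h0 hhj,
        zero_mul, mul_zero, zero_add, zero_add]
      have := sum_antidiagonal_eq_sum_box
        (fun u v => pathWeight N w (u + 1) i h * pathWeight N w (v + 1) h j) (h - i) (j - h) r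
        (fun u v huv => by
          rcases huv with huv | huv
          · rw [pathWeight_eq_zero hw (k := u + 1) (by omega), zero_mul]
          · rw [pathWeight_eq_zero hw (k := v + 1) (by omega), mul_zero])
      rw [this]
      refine Finset.sum_congr rfl fun u _ => Finset.sum_congr rfl fun v _ => ?_
      exact if_congr (by omega) rfl rfl
  · rw [sum_antidiagonal_eq_sum_box (fun u v => passingWeight N w h j u v i) (h - i) (j - h) r
      (fun u v huv => passingWeight_eq_zero hw (by omega))]
    refine Finset.sum_congr rfl fun u _ => Finset.sum_congr rfl fun v _ => ?_
    exact if_congr (by omega) rfl rfl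

end Paths

/-! ## Lines and segments in the plane -/

/-- The second coordinate of the point with first coordinate `x` on the line through `a`, `b`. -/
noncomputable def lineAt (a b : ℝ × ℝ) (x : ℝ) : ℝ :=
  a.2 + (b.2 - a.2) / (b.1 - a.1) * (x - a.1)

theorem lineAt_left (a b : ℝ × ℝ) : lineAt a b a.1 = a.2 := by simp [lineAt]

theorem lineAt_right {a b : ℝ × ℝ} (h : a.1 < b.1) : lineAt a b b.1 = b.2 := by
  have : b.1 - a.1 ≠ 0 := by linarith
  rw [lineAt, div_mul_cancel₀ _ this]; ring

theorem lineAt_combo (a b : ℝ × ℝ) {s t : ℝ} (hst : s + t = 1) (x y : ℝ) :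
    lineAt a b (s * x + t * y) = s * lineAt a b x + t * lineAt a b y := by
  have : s = 1 - t := by linarith
  subst this
  simp only [lineAt]; ring

theorem exists_combo {x₁ x x₂ : ℝ} (h₁ : x₁ ≤ x) (h₂ : x ≤ x₂) :
    ∃ s t : ℝ, 0 ≤ s ∧ 0 ≤ t ∧ s + t = 1 ∧ x = s * x₁ + t * x₂ := by
  have : x ∈ segment ℝ x₁ x₂ := by
    rw [segment_eq_Icc (h₁.trans h₂)]; exact ⟨h₁, h₂⟩
  obtain ⟨s, t, hs, ht, hst, h⟩ := this
  exact ⟨s, t, hs, ht, hst, h.symm⟩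

theorem signedArea_eq {a c : ℝ × ℝ} (h : a.1 < c.1) (b : ℝ × ℝ) :
    signedArea a b c = (lineAt a c b.1 - b.2) * (c.1 - a.1) := by
  have : c.1 - a.1 ≠ 0 := by linarith
  simp only [signedArea, lineAt]; field_simp; ring

theorem mem_segment_iff_lineAt {a b : ℝ × ℝ} (h : a.1 < b.1) (q : ℝ × ℝ) :
    q ∈ segment ℝ a b ↔ a.1 ≤ q.1 ∧ q.1 ≤ b.1 ∧ q.2 = lineAt a b q.1 := by
  constructor
  · rintro ⟨s, t, hs, ht, hst, rfl⟩
    have hs' : s = 1 - t := by linarith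
    simp only [Prod.fst_add, Prod.smul_fst, smul_eq_mul, Prod.snd_add, Prod.smul_snd]
    refine ⟨by subst hs'; nlinarith, by subst hs'; nlinarith, ?_⟩
    rw [lineAt_combo _ _ hst, lineAt_left, lineAt_right h]
  · rintro ⟨h1, h2, h3⟩
    obtain ⟨s, t, hs, ht, hst, hx⟩ := exists_combo h1 h2
    refine ⟨s, t, hs, ht, hst, Prod.ext hx.symm ?_⟩
    rw [h3, hx, lineAt_combo _ _ hst, lineAt_left, lineAt_right h]
    rfl

theorem collinear_of_lineAt {a b c : ℝ × ℝ} (h : a.1 < c.1) (hb : b.2 = lineAt a c b.1) :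
    Collinear ℝ {a, b, c} := by
  have h0 : c.1 - a.1 ≠ 0 := by linarith
  rw [collinear_iff_of_mem (p₀ := a) (by simp)]
  refine ⟨c - a, ?_⟩
  rintro q (rfl | rfl | rfl)
  · exact ⟨0, by simp⟩
  · refine ⟨(q.1 - a.1) / (c.1 - a.1), Prod.ext ?_ ?_⟩
    · simp only [vadd_eq_add, Prod.fst_add, Prod.smul_fst, Prod.fst_sub, smul_eq_mul]
      field_simp; ring
    · simp only [vadd_eq_add, Prod.snd_add, Prod.smul_snd, Prod.snd_sub, smul_eq_mul]
      rw [hb, lineAt]; ring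
  · exact ⟨1, by simp⟩

/-- The intermediate value theorem for the vertical distance of the two lines, on an interval over
which both segments extend. -/
theorem segments_inter_nonempty {a b c d : ℝ × ℝ} (hab : a.1 < b.1) (hcd : c.1 < d.1) {x₁ x₂ : ℝ}
    (hx : x₁ ≤ x₂) (ha : a.1 ≤ x₁) (hc : c.1 ≤ x₁) (hb : x₂ ≤ b.1) (hd : x₂ ≤ d.1)
    (hs : (lineAt a b x₁ - lineAt c d x₁) * (lineAt a b x₂ - lineAt c d x₂) ≤ 0) :
    (segment ℝ a b ∩ segment ℝ c d).Nonempty := by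
  have hcont : ContinuousOn (fun x => lineAt a b x - lineAt c d x) (Set.uIcc x₁ x₂) := by
    unfold lineAt; fun_prop
  have h0 : (0 : ℝ) ∈ Set.uIcc (lineAt a b x₁ - lineAt c d x₁) (lineAt a b x₂ - lineAt c d x₂) := by
    rw [Set.mem_uIcc]
    rcases mul_nonpos_iff.1 hs with h | h
    · exact Or.inr ⟨h.2, h.1⟩
    · exact Or.inl h
  obtain ⟨x, hx', hx0⟩ := intermediate_value_uIcc hcont h0
  rw [Set.uIcc_of_le hx] at hx'
  refine ⟨(x, lineAt a b x), (mem_segment_iff_lineAt hab _).2 ⟨?_, ?_, rfl⟩,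
    (mem_segment_iff_lineAt hcd _).2 ⟨?_, ?_, ?_⟩⟩ <;> simp only at * <;> linarith [hx'.1, hx'.2]

/-! ## Visibility in a chain -/

section Visibility

variable {n : ℕ} {p : Fin (n + 1) → ℝ × ℝ}

theorem lineAt_sub_ne_zero (hp : SortedGeneralPosition p) {i k j : Fin (n + 1)} (hik : i < k)
    (hkj : k < j) : lineAt (p i) (p j) (p k).1 - (p k).2 ≠ 0 := fun h =>
  hp.not_collinear i k j hik hkj
    (collinear_of_lineAt (hp.x_strictMono (hik.trans hkj)) (by linarith))

theorem signedArea_pos_iff (hp : SortedGeneralPosition p) {i j : Fin (n + 1)} (hij : i < j)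
    (k : Fin (n + 1)) :
    0 < signedArea (p i) (p k) (p j) ↔ 0 < lineAt (p i) (p j) (p k).1 - (p k).2 := by
  have h := hp.x_strictMono hij
  simp only at h
  rw [signedArea_eq h]
  exact mul_pos_iff_of_pos_right (by linarith)

theorem signedArea_neg_iff (hp : SortedGeneralPosition p) {i j : Fin (n + 1)} (hij : i < j)
    (k : Fin (n + 1)) :
    signedArea (p i) (p k) (p j) < 0 ↔ lineAt (p i) (p j) (p k).1 - (p k).2 < 0 := by
  have h := hp.x_strictMono hij
  simp only at h
  rw [signedArea_eq h]
  exact ⟨fun h' => neg_of_mul_neg_left h' (by linarith), fun h' => mul_neg_of_neg_of_pos h' (by linarith)⟩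

theorem visibility_of_le {i j : Fin (n + 1)} (h : (j : ℕ) ≤ i + 1) : visibility p i j = 0 :=
  if_pos h

theorem lt_of_visibility {i j : Fin (n + 1)} (h : visibility p i j ≠ 0) : (i : ℕ) + 1 < j := by
  by_contra hc
  exact h (visibility_of_le (by omega))

theorem sign_of_visibility (hp : SortedGeneralPosition p) {σ : ℤ} (hσ : σ = 1 ∨ σ = -1)
    {i j : Fin (n + 1)} (h : visibility p i j = σ) {k : Fin (n + 1)} (hik : i < k) (hkj : k < j) :
    0 < (σ : ℝ) * (lineAt (p i) (p j) (p k).1 - (p k).2) := by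
  have hij := hik.trans hkj
  rw [visibility] at h
  split_ifs at h with h1 h2 h3
  · omega
  · subst h
    have := (signedArea_pos_iff hp hij k).1 (h2 k hik hkj)
    push_cast; linarith
  · subst h
    have := (signedArea_neg_iff hp hij k).1 (h3 k hik hkj)
    push_cast; linarith
  · omega

theorem exists_isTriangulation {m : ℕ} {p : Fin m → ℝ × ℝ} {G : SimpleGraph (Fin m)}
    (hG : CrossingFree p G) : ∃ G', G ≤ G' ∧ IsTriangulation p G' :=
  (Set.toFinite {G | CrossingFree p G}).exists_le_maximal hG

/-- Otherwise the segment `p i p j` would meet the chain edge `p k p l`. Extending the single edge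
`(i, j)` to a triangulation, which contains `(k, l)` by unavoidability, gives a contradiction. -/
theorem sign_consecutive (hp : IsPointChain p) {i j k l : Fin (n + 1)} (hik : i < k)
    (hkl : (l : ℕ) = k + 1) (hlj : l < j) :
    0 < (lineAt (p i) (p j) (p k).1 - (p k).2) * (lineAt (p i) (p j) (p l).1 - (p l).2) := by
  have hmono := hp.generalPosition.x_strictMono
  have hkl' : k < l := Fin.lt_def.2 (by omega)
  have hij : i < j := hik.trans (hkl'.trans hlj)
  by_contra hcon
  push Not at hcon
  have hxij := hmono hij
  have hxkl := hmono hkl'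
  have hxik := hmono hik
  have hxlj := hmono hlj
  simp only at hxij hxkl hxik hxlj
  obtain ⟨q, hq⟩ := segments_inter_nonempty (a := p i) (b := p j) (c := p k) (d := p l)
    hxij hxkl hxkl.le hxik.le le_rfl hxlj.le le_rfl
    (by rw [lineAt_left, lineAt_right hxkl]; exact hcon)
  have hfree : CrossingFree p (SimpleGraph.fromEdgeSet {s(i, j)}) := by
    intro a b c d hab hcd hne
    rw [SimpleGraph.fromEdgeSet_adj] at hab hcd
    exact absurd (hab.1.trans hcd.1.symm) hne
  obtain ⟨G, hle, hG⟩ := exists_isTriangulation hfree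
  have h1 : G.Adj i j := hle (by rw [SimpleGraph.fromEdgeSet_adj]; exact ⟨rfl, hij.ne⟩)
  have hkn : (k : ℕ) < n := by have := l.isLt; omega
  have h2 : G.Adj k l := by
    have := hp.unavoidable ⟨k, hkn⟩ G hG
    rwa [show l = Fin.succ ⟨k, hkn⟩ from Fin.ext hkl]
  have hinj := hmono.injective
  have hne : ∀ x y : Fin (n + 1), x < y → p x ≠ p y := fun x y hxy h =>
    (hmono hxy).ne (congrArg Prod.fst h)
  have hsub := hG.1 i j k l h1 h2 (by
    intro h
    rw [Sym2.eq_iff] at h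
    rcases h with ⟨rfl, -⟩ | ⟨rfl, -⟩
    · exact lt_irrefl _ hik
    · exact lt_irrefl _ (hik.trans hkl')) hq
  obtain ⟨rfl | rfl, h | h⟩ := hsub
  · exact hne _ _ hik h
  · exact hne _ _ (hik.trans hkl') h
  · exact hne _ _ (hkl'.trans hlj) h.symm
  · exact hne _ _ hlj h.symm

/-- By `sign_consecutive` the side of the segment cannot change from one intermediate point to the
next, so the first one determines the sign. -/
theorem visibility_eq_or (hp : IsPointChain p) {i j : Fin (n + 1)} (hij : (i : ℕ) + 1 < j) :
    visibility p i j = 1 ∨ visibility p i j = -1 := by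
  have hij' : i < j := Fin.lt_def.2 (by omega)
  have hjn := j.isLt
  let s : ℕ → ℝ := fun k => if h : k < n + 1 then
    lineAt (p i) (p j) (p ⟨k, h⟩).1 - (p ⟨k, h⟩).2 else 0
  have hs : ∀ k : Fin (n + 1), s k = lineAt (p i) (p j) (p k).1 - (p k).2 := fun k => by
    simp only [s, dif_pos k.isLt]
  have hstep : ∀ k, (i : ℕ) < k → k + 1 < j → 0 < s k * s (k + 1) := by
    intro k h1 h2
    have := sign_consecutive hp (i := i) (j := j) (k := ⟨k, by omega⟩) (l := ⟨k + 1, by omega⟩)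
      (Fin.lt_def.2 h1) rfl (Fin.lt_def.2 h2)
    rw [← hs, ← hs] at this
    exact this
  have hfirst : s (i + 1) ≠ 0 := by
    have := lineAt_sub_ne_zero hp.generalPosition (i := i) (k := ⟨i + 1, by omega⟩) (j := j)
      (Fin.lt_def.2 (Nat.lt_succ_self _)) (Fin.lt_def.2 hij)
    rwa [← hs] at this
  have hall : ∀ m, (i : ℕ) + 1 + m < j → 0 < s (i + 1) * s (i + 1 + m) := by
    intro m
    induction m with
    | zero => intro _; exact mul_self_pos.2 hfirst
    | succ m ih =>
      intro hm
      have h1 := ih (by omega)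
      have h2 := hstep (i + 1 + m) (by omega) (by omega)
      -- The signs of two products with the common factor `s (i + 1 + m)` are combined, and its
      -- square is cancelled.
      have h3 : 0 < (s (i + 1) * s (i + 1 + (m + 1))) * (s (i + 1 + m) * s (i + 1 + m)) := by
        calc (0 : ℝ) < _ := mul_pos h1 h2
          _ = _ := by rw [show (i : ℕ) + 1 + (m + 1) = i + 1 + m + 1 by omega]; ring
      exact pos_of_mul_pos_left h3 (mul_self_nonneg _)
  have hall' : ∀ k : Fin (n + 1), i < k → k < j → 0 < s (i + 1) * s k := by
    intro k h1 h2
    have := hall (k - (i + 1)) (by rw [Fin.lt_def] at h1 h2; omega)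
    rwa [show (i : ℕ) + 1 + (k - (i + 1)) = k by rw [Fin.lt_def] at h1 h2; omega] at this
  rw [visibility, if_neg (by omega)]
  rcases lt_or_gt_of_ne hfirst with h | h
  · right
    rw [if_neg, if_pos]
    · intro k h1 h2
      rw [signedArea_neg_iff hp.generalPosition hij', ← hs]
      exact neg_of_mul_pos_right (hall' k h1 h2) h.le
    · intro hc
      have h1 := hc ⟨i + 1, by omega⟩ (Fin.lt_def.2 (Nat.lt_succ_self _)) (Fin.lt_def.2 hij)
      rw [signedArea_pos_iff hp.generalPosition hij', ← hs] at h1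
      exact lt_asymm h h1
  · left
    rw [if_pos]
    intro k h1 h2
    rw [signedArea_pos_iff hp.generalPosition hij', ← hs]
    exact pos_of_mul_pos_right (hall' k h1 h2) h.le

/-- Take `h` with the greatest deviation from the segment `p i p j`, measured in the direction `σ`.
A segment `p a p b` over `h` joins points of no greater deviation, so it cannot leave `p h` strictly
on the wrong side. -/
theorem visibility_exists_split (hp : IsPointChain p) {i j : Fin (n + 1)} (hij : (i : ℕ) + 1 < j) :
    ∃ h, i < h ∧ h < j ∧ ∀ a b, i ≤ a → a < h → h < b → b ≤ j →
      visibility p a b = visibility p i j := by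
  have hgp := hp.generalPosition
  have hmono := hgp.x_strictMono
  obtain ⟨σ, hσ⟩ : ∃ σ, visibility p i j = σ := ⟨_, rfl⟩
  have hσ1 : σ = 1 ∨ σ = -1 := hσ ▸ visibility_eq_or hp hij
  have hij' : i < j := Fin.lt_def.2 (by omega)
  have hxij := hmono hij'
  simp only at hxij
  let s : Fin (n + 1) → ℝ := fun k => (σ : ℝ) * (lineAt (p i) (p j) (p k).1 - (p k).2)
  have hne : (Finset.Ioo i j).Nonempty :=
    ⟨⟨i + 1, by omega⟩, Finset.mem_Ioo.2 ⟨Fin.lt_def.2 (Nat.lt_succ_self _), Fin.lt_def.2 hij⟩⟩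
  obtain ⟨h, hh, hmax⟩ := Finset.exists_max_image (Finset.Ioo i j) s hne
  rw [Finset.mem_Ioo] at hh
  have hpos : 0 < s h := sign_of_visibility hgp hσ1 hσ hh.1 hh.2
  have hle : ∀ k, i ≤ k → k ≤ j → s k ≤ s h := by
    intro k h1 h2
    rcases h1.eq_or_lt with rfl | h1
    · simp only [s, lineAt_left, sub_self, mul_zero]; exact hpos.le
    rcases h2.eq_or_lt with rfl | h2
    · simp only [s, lineAt_right hxij, sub_self, mul_zero]; exact hpos.le
    exact hmax k (Finset.mem_Ioo.2 ⟨h1, h2⟩)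
  refine ⟨h, hh.1, hh.2, fun a b hia hah hhb hbj => ?_⟩
  rw [hσ]
  by_contra hcon
  have hab : visibility p a b = -σ := by
    have := visibility_eq_or hp (i := a) (j := b) (by rw [Fin.lt_def] at hah hhb; omega)
    omega
  have h1 := sign_of_visibility hgp (by omega) hab hah hhb
  have h2 := hle a hia ((hah.trans hh.2).le)
  have h3 := hle b ((hh.1.trans hhb).le) hbj
  have hxab := hmono (hah.trans hhb)
  simp only at hxab
  obtain ⟨x, y, hx, hy, hxy, hcombo⟩ := exists_combo (hmono hah).le (hmono hhb).le
  simp only at hcombo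
  have e1 := lineAt_combo (p i) (p j) hxy (p a).1 (p b).1
  have e2 := lineAt_combo (p a) (p b) hxy (p a).1 (p b).1
  rw [lineAt_left, lineAt_right hxab] at e2
  rw [← hcombo] at e1 e2
  -- The deviation of the segment `p a p b` above the abscissa of `p h` is this convex combination.
  have h4 : x * s a + y * s b ≤ s h := by
    have : s h = x * s h + y * s h := by rw [← add_mul, hxy, one_mul]
    rw [this]
    exact add_le_add (mul_le_mul_of_nonneg_left h2 hx) (mul_le_mul_of_nonneg_left h3 hy)
  simp only [s] at h4
  rw [e1] at h4
  rw [e2] at h1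
  push_cast at h1
  nlinarith [h1, h4]

end Visibility

/-! ## Crossing-free graphs on a chain -/

section Count

variable {n : ℕ} {p : Fin (n + 1) → ℝ × ℝ}

/-- All points between `a` and `b` lie strictly on one side of the outer segment. The inner segment
can touch it only at a shared endpoint, whatever its own sign. -/
theorem segments_inter_nested (hp : SortedGeneralPosition p) {σ : ℤ} (hσ : σ = 1 ∨ σ = -1)
    {a b c d : Fin (n + 1)} (hac : a ≤ c) (hcd : c < d) (hdb : d ≤ b) (hne : a < c ∨ d < b)
    (hv : visibility p a b = σ) {q : ℝ × ℝ} (hq : q ∈ segment ℝ (p a) (p b))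
    (hq' : q ∈ segment ℝ (p c) (p d)) : q = p a ∧ q = p c ∨ q = p b ∧ q = p d := by
  have hmono := hp.x_strictMono
  have hab : a < b := hac.trans_lt (hcd.trans_le hdb)
  have hxab := hmono hab
  simp only at hxab
  let s : Fin (n + 1) → ℝ := fun k => (σ : ℝ) * (lineAt (p a) (p b) (p k).1 - (p k).2)
  have hs : ∀ k, a ≤ k → k ≤ b → 0 ≤ s k ∧ (a < k → k < b → 0 < s k) := by
    intro k h1 h2
    refine ⟨?_, fun h1 h2 => sign_of_visibility hp hσ hv h1 h2⟩
    rcases h1.eq_or_lt with rfl | h1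
    · simp [s, lineAt_left]
    rcases h2.eq_or_lt with rfl | h2
    · simp [s, lineAt_right hxab]
    exact (sign_of_visibility hp hσ hv h1 h2).le
  have hsc := hs c hac (hcd.le.trans hdb)
  have hsd := hs d (hac.trans hcd.le) hdb
  rw [mem_segment_iff_lineAt hxab] at hq
  obtain ⟨x, y, hx, hy, hxy, rfl⟩ := hq'
  obtain ⟨-, -, h⟩ := hq
  simp only [Prod.fst_add, Prod.smul_fst, smul_eq_mul, Prod.snd_add, Prod.smul_snd] at h
  rw [lineAt_combo _ _ hxy] at h
  have h0 : x * s c + y * s d = 0 := by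
    simp only [s]
    linear_combination -(σ : ℝ) * h
  have hx0 := mul_nonneg hx hsc.1
  have hy0 := mul_nonneg hy hsd.1
  have hxs : x * s c = 0 := by linarith
  have hys : y * s d = 0 := by linarith
  rcases hac.eq_or_lt with rfl | hac
  · have hdb' : d < b := by
      rcases hne with h | h
      · exact absurd h (lt_irrefl _)
      · exact h
    have hy1 : y = 0 := by
      rcases mul_eq_zero.1 hys with h | h
      · exact h
      · exact absurd h (hsd.2 hcd hdb').ne'
    have hx1 : x = 1 := by linarith
    left; simp [hx1, hy1]
  · have hx1 : x = 0 := by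
      rcases mul_eq_zero.1 hxs with h | h
      · exact h
      · exact absurd h (hsc.2 hac (hcd.trans_le hdb)).ne'
    have hy1 : y = 1 := by linarith
    rcases hdb.eq_or_lt with rfl | hdb
    · right; simp [hx1, hy1]
    · exfalso
      have := hsd.2 (hac.trans hcd) hdb
      rw [hy1, one_mul] at hys
      exact this.ne' hys

/-- For `σ = 1`, the point `p c` lies below `p a p b` and `p b` lies above `p c p d`. The first
segment is thus above the second at both ends of their common range of abscissas, hence throughout.
For `σ = -1` the roles are reversed. -/
theorem segments_inter_interleave (hp : SortedGeneralPosition p) {σ : ℤ} (hσ : σ = 1 ∨ σ = -1)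
    {a b c d : Fin (n + 1)} (hac : a < c) (hcb : c < b) (hbd : b < d)
    (hv : visibility p a b = σ) (hv' : visibility p c d = -σ) {q : ℝ × ℝ}
    (hq : q ∈ segment ℝ (p a) (p b)) (hq' : q ∈ segment ℝ (p c) (p d)) : False := by
  have hmono := hp.x_strictMono
  have hxab := hmono (hac.trans hcb)
  have hxcd := hmono (hcb.trans hbd)
  simp only at hxab hxcd
  have h1 := sign_of_visibility hp hσ hv hac hcb
  have h2 := sign_of_visibility hp (by omega) hv' hcb hbd
  rw [mem_segment_iff_lineAt hxab] at hq
  rw [mem_segment_iff_lineAt hxcd] at hq'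
  obtain ⟨x, y, hx, hy, hxy, hcombo⟩ := exists_combo hq'.1 hq.2.1
  have e1 := lineAt_combo (p a) (p b) hxy (p c).1 (p b).1
  have e2 := lineAt_combo (p c) (p d) hxy (p c).1 (p b).1
  rw [← hcombo, ← hq.2.2, lineAt_right hxab] at e1
  rw [← hcombo, ← hq'.2.2, lineAt_left] at e2
  push_cast at h2
  have h3 : x * ((σ : ℝ) * (lineAt (p a) (p b) (p c).1 - (p c).2)) +
      y * (-(σ : ℝ) * (lineAt (p c) (p d) (p b).1 - (p b).2)) = 0 := by
    linear_combination (σ : ℝ) * (e2 - e1)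
  have hx0 := mul_nonneg hx h1.le
  have hy0 := mul_nonneg hy h2.le
  rcases mul_eq_zero.1 (by linarith : x * ((σ : ℝ) * (lineAt (p a) (p b) (p c).1 - (p c).2)) = 0)
    with h | h
  · have hy1 : y = 1 := by linarith
    rw [h, hy1] at h3
    linarith
  · linarith

/-- The edges of `G` with visibility `σ`. -/
def edgesOf (p : Fin (n + 1) → ℝ × ℝ) (σ : ℤ) (G : SimpleGraph (Fin (n + 1))) : Set (ℕ × ℕ) :=
  {e | ∃ x y : Fin (n + 1), e = ((x : ℕ), (y : ℕ)) ∧ G.Adj x y ∧ visibility p x y = σ}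

/-- Interleaving edges of equal sign exchange their vertical order between `c` and `b`, so they meet
away from common endpoints. All other pairs are harmless: side by side, nested, or interleaving with
opposite signs. -/
theorem crossingFree_iff (hp : IsPointChain p) (G : SimpleGraph (Fin (n + 1))) :
    CrossingFree p G ↔ Noncrossing (edgesOf p 1 G) ∧ Noncrossing (edgesOf p (-1) G) := by
  have hgp := hp.generalPosition
  have hmono := hgp.x_strictMono
  have hne : ∀ x y : Fin (n + 1), x < y → p x ≠ p y := fun x y hxy h =>
    (hmono hxy).ne (congrArg Prod.fst h)
  constructor
  · intro hG
    have aux : ∀ σ : ℤ, (σ = 1 ∨ σ = -1) → Noncrossing (edgesOf p σ G) := by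
      rintro σ hσ _ ⟨a, b, rfl, hab, hv⟩ _ ⟨c, d, rfl, hcd, hv'⟩ ⟨hac, hcb, hbd⟩
      simp only [← Fin.lt_def] at hac hcb hbd
      have h1 := sign_of_visibility hgp hσ hv hac hcb
      have h2 := sign_of_visibility hgp hσ hv' hcb hbd
      have hxab := hmono (hac.trans hcb)
      have hxcd := hmono (hcb.trans hbd)
      simp only at hxab hxcd
      obtain ⟨q, hq⟩ := segments_inter_nonempty hxab hxcd (hmono hcb).le (hmono hac).le le_rfl
        le_rfl (hmono hbd).le (by
          simp only
          rw [lineAt_left, lineAt_right hxab]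
          have hσ2 : (σ : ℝ) * σ = 1 := by rcases hσ with rfl | rfl <;> norm_num
          nlinarith [mul_pos h1 h2])
      have hsub := hG a b c d hab hcd (by
        intro h
        rw [Sym2.eq_iff] at h
        rcases h with ⟨rfl, -⟩ | ⟨rfl, -⟩
        · exact lt_irrefl _ hac
        · exact lt_irrefl _ (hac.trans (hcb.trans hbd))) hq
      obtain ⟨rfl | rfl, h | h⟩ := hsub
      · exact hne _ _ hac h
      · exact hne _ _ (hac.trans (hcb.trans hbd)) h
      · exact hne _ _ hcb h.symm
      · exact hne _ _ hbd h
    exact ⟨aux 1 (Or.inl rfl), aux (-1) (Or.inr rfl)⟩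
  · rintro ⟨hup, hdown⟩
    have hnc : ∀ σ : ℤ, (σ = 1 ∨ σ = -1) → Noncrossing (edgesOf p σ G) := by
      rintro σ (rfl | rfl)
      · exact hup
      · exact hdown
    have aux : ∀ a b c d : Fin (n + 1), G.Adj a b → G.Adj c d → a < b → c < d → a ≤ c →
        ¬ (a = c ∧ b = d) → ∀ q, q ∈ segment ℝ (p a) (p b) → q ∈ segment ℝ (p c) (p d) →
        q ∈ ({p a, p b} : Set (ℝ × ℝ)) ∩ {p c, p d} := by
      intro a b c d hab hcd hlt hlt' hac hne' q hq hq'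
      have nested : ∀ a b c d : Fin (n + 1), a ≤ c → c < d → d ≤ b → a < c ∨ d < b →
          q ∈ segment ℝ (p a) (p b) → q ∈ segment ℝ (p c) (p d) →
          q ∈ ({p a, p b} : Set (ℝ × ℝ)) ∩ {p c, p d} := by
        intro a b c d h1 h2 h3 h4 hq hq'
        have hvis := visibility_eq_or hp (i := a) (j := b)
          (by rw [Fin.lt_def] at h2; simp only [Fin.le_def, Fin.lt_def] at h1 h3 h4; omega)
        rcases segments_inter_nested hgp hvis h1 h2 h3 h4 rfl hq hq' with ⟨h5, h6⟩ | ⟨h5, h6⟩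
        · exact ⟨Or.inl h5, Or.inl h6⟩
        · exact ⟨Or.inr h5, Or.inr h6⟩
      rcases le_or_gt b c with hbc | hcb
      · have h1 := (mem_segment_iff_lineAt (hmono hlt) q).1 hq
        have h2 := (mem_segment_iff_lineAt (hmono hlt') q).1 hq'
        have h3 := hmono.monotone hbc
        have h4 : (p b).1 = (p c).1 := by linarith [h1.2.1, h2.1]
        obtain rfl : b = c := hmono.injective h4
        have h5 : q.1 = (p b).1 := le_antisymm h1.2.1 h2.1
        have h6 : q = p b := Prod.ext h5 (by rw [h1.2.2, h5, lineAt_right (hmono hlt)])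
        exact ⟨Or.inr h6, Or.inl h6⟩
      rcases le_or_gt d b with hdb | hbd
      · refine nested a b c d hac hlt' hdb ?_ hq hq'
        by_contra hcon
        push Not at hcon
        exact hne' ⟨le_antisymm hac hcon.1, le_antisymm hcon.2 hdb⟩
      rcases hac.eq_or_lt with rfl | hac
      -- With a common left endpoint, the edge with the farther right endpoint is the outer one;
      -- here it is the second.
      · exact (nested a d a b le_rfl hlt hbd.le (Or.inr hbd) hq' hq).symm
      exfalso
      have hv1 := visibility_eq_or hp (i := a) (j := b)
        (by simp only [Fin.lt_def] at hac hcb; omega)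
      have hv2 := visibility_eq_or hp (i := c) (j := d)
        (by simp only [Fin.lt_def] at hcb hbd; omega)
      by_cases hsame : visibility p c d = visibility p a b
      · exact hnc _ hv1 (a, b) ⟨a, b, rfl, hab, rfl⟩ (c, d) ⟨c, d, rfl, hcd, hsame⟩
          ⟨hac, hcb, hbd⟩
      · exact segments_inter_interleave hgp hv1 hac hcb hbd rfl (by omega) hq hq'
    have aux2 : ∀ a b c d : Fin (n + 1), G.Adj a b → G.Adj c d → a < b → c < d →
        ¬ (a = c ∧ b = d) → ∀ q, q ∈ segment ℝ (p a) (p b) → q ∈ segment ℝ (p c) (p d) →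
        q ∈ ({p a, p b} : Set (ℝ × ℝ)) ∩ {p c, p d} := by
      intro a b c d hab hcd hlt hlt' hne' q hq hq'
      rcases le_total a c with h | h
      · exact aux a b c d hab hcd hlt hlt' h hne' q hq hq'
      · exact (aux c d a b hcd hab hlt' hlt h (fun h => hne' ⟨h.1.symm, h.2.symm⟩) q hq' hq).symm
    rintro a b c d hab hcd hne' q ⟨hq, hq'⟩
    rcases lt_or_gt_of_ne hab.ne with h1 | h1 <;> rcases lt_or_gt_of_ne hcd.ne with h2 | h2
    · exact aux2 a b c d hab hcd h1 h2 (by rintro ⟨rfl, rfl⟩; exact hne' rfl) q hq hq'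
    · rw [segment_symm] at hq'
      rw [Set.pair_comm (p c)]
      exact aux2 a b d c hab hcd.symm h1 h2 (by rintro ⟨rfl, rfl⟩; exact hne' Sym2.eq_swap)
        q hq hq'
    · rw [segment_symm] at hq
      rw [Set.pair_comm (p a)]
      exact aux2 b a c d hab.symm hcd h1 h2 (by rintro ⟨rfl, rfl⟩; exact hne' Sym2.eq_swap)
        q hq hq'
    · rw [segment_symm] at hq hq'
      rw [Set.pair_comm (p a), Set.pair_comm (p c)]
      exact aux2 b a d c hab.symm hcd.symm h1 h2 (by rintro ⟨rfl, rfl⟩; exact hne' rfl)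
        q hq hq'

/-- The visibility triangle with natural numbers as indices. -/
noncomputable def visibilityNat (p : Fin (n + 1) → ℝ × ℝ) (a b : ℕ) : ℤ :=
  if h : a < n + 1 ∧ b < n + 1 then visibility p ⟨a, h.1⟩ ⟨b, h.2⟩ else 0

theorem visibilityNat_coe (x y : Fin (n + 1)) : visibilityNat p x y = visibility p x y :=
  dif_pos ⟨x.isLt, y.isLt⟩

theorem exists_fin_of_visibilityNat {a b : ℕ} (h : visibilityNat p a b ≠ 0) :
    ∃ x y : Fin (n + 1), a = x ∧ b = y ∧ visibility p x y = visibilityNat p a b := by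
  rw [visibilityNat] at h ⊢
  split_ifs at h ⊢ with h1
  · exact ⟨⟨a, h1.1⟩, ⟨b, h1.2⟩, rfl, rfl, rfl⟩
  · exact absurd rfl h

/-- The graph with the chain edges and the edges in `S` and `T`. -/
def chainGraph (n : ℕ) (S T : Set (ℕ × ℕ)) : SimpleGraph (Fin (n + 1)) :=
  SimpleGraph.fromRel fun x y =>
    (y : ℕ) = x + 1 ∨ ((x : ℕ), (y : ℕ)) ∈ S ∨ ((x : ℕ), (y : ℕ)) ∈ T

theorem chainGraph_mono {S S' T T' : Set (ℕ × ℕ)} (hS : S ⊆ S') (hT : T ⊆ T') :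
    chainGraph n S T ≤ chainGraph n S' T' := by
  have hmono : ∀ x y : Fin (n + 1),
      ((y : ℕ) = x + 1 ∨ ((x : ℕ), (y : ℕ)) ∈ S ∨ ((x : ℕ), (y : ℕ)) ∈ T) →
      ((y : ℕ) = x + 1 ∨ ((x : ℕ), (y : ℕ)) ∈ S' ∨ ((x : ℕ), (y : ℕ)) ∈ T') :=
    fun x y h => h.imp_right fun h => h.imp (fun h => hS h) fun h => hT h
  intro x y h
  rw [chainGraph, SimpleGraph.fromRel_adj] at h ⊢
  exact ⟨h.1, h.2.imp (hmono x y) (hmono y x)⟩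

theorem edgesOf_mono {σ : ℤ} {G G' : SimpleGraph (Fin (n + 1))} (h : G ≤ G') :
    edgesOf p σ G ⊆ edgesOf p σ G' := by
  rintro e ⟨x, y, rfl, hxy, hv⟩
  exact ⟨x, y, rfl, h hxy, hv⟩

theorem edgesOf_chainGraph {σ : ℤ} (hσ : σ = 1 ∨ σ = -1) {S T : Set (ℕ × ℕ)}
    (hS : ∀ e ∈ S, visibilityNat p e.1 e.2 = σ) (hT : ∀ e ∈ T, visibilityNat p e.1 e.2 = -σ) :
    edgesOf p σ (chainGraph n S T) = S ∧ edgesOf p σ (chainGraph n T S) = S := by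
  have aux : ∀ e : ℕ × ℕ, (∃ x y : Fin (n + 1), e = ((x : ℕ), (y : ℕ)) ∧
      (chainGraph n S T).Adj x y ∧ visibility p x y = σ) ↔ e ∈ S := by
    intro e
    constructor
    · rintro ⟨x, y, rfl, hxy, hv⟩
      have hlt := lt_of_visibility (p := p) (i := x) (j := y) (by omega)
      rw [chainGraph, SimpleGraph.fromRel_adj] at hxy
      have hback : ∀ h : visibility p y x ≠ 0, False := fun h => by
        have := lt_of_visibility h; omega
      rcases hxy.2 with (h | h | h) | (h | h | h)
      · omega
      · exact h
      · have := hT _ h; rw [visibilityNat_coe] at this; omega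
      · omega
      · have := hS _ h; rw [visibilityNat_coe] at this; exact (hback (by omega)).elim
      · have := hT _ h; rw [visibilityNat_coe] at this; exact (hback (by omega)).elim
    · intro he
      have h1 := hS e he
      obtain ⟨x, y, hx, hy, hv⟩ := exists_fin_of_visibilityNat (p := p) (a := e.1) (b := e.2)
        (by omega)
      have hlt := lt_of_visibility (p := p) (i := x) (j := y) (by omega)
      refine ⟨x, y, Prod.ext hx hy, ?_, hv.trans h1⟩
      rw [chainGraph, SimpleGraph.fromRel_adj]
      refine ⟨fun h => by rw [h] at hlt; omega, Or.inl (Or.inr (Or.inl ?_))⟩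
      rw [← hx, ← hy]; exact he
  have hcomm : chainGraph n T S = chainGraph n S T := by
    simp only [chainGraph, or_comm]
  exact ⟨Set.ext aux, by rw [hcomm]; exact Set.ext aux⟩

theorem le_chainGraph (hp : IsPointChain p) (G : SimpleGraph (Fin (n + 1))) :
    G ≤ chainGraph n (edgesOf p 1 G) (edgesOf p (-1) G) := by
  have aux : ∀ x y : Fin (n + 1), x < y → G.Adj x y → (y : ℕ) = x + 1 ∨
      ((x : ℕ), (y : ℕ)) ∈ edgesOf p 1 G ∨ ((x : ℕ), (y : ℕ)) ∈ edgesOf p (-1) G := by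
    intro x y hlt hxy
    rw [Fin.lt_def] at hlt
    by_cases h : (y : ℕ) = x + 1
    · exact Or.inl h
    · exact Or.inr ((visibility_eq_or hp (i := x) (j := y) (by omega)).imp
        (fun h => ⟨x, y, rfl, hxy, h⟩) fun h => ⟨x, y, rfl, hxy, h⟩)
  intro x y hxy
  rw [chainGraph, SimpleGraph.fromRel_adj]
  refine ⟨hxy.ne, ?_⟩
  rcases lt_or_gt_of_ne hxy.ne with h | h
  · exact Or.inl (aux x y h hxy)
  · exact Or.inr (aux y x h hxy.symm)

theorem admissible_edgesOf {σ : ℤ} {G : SimpleGraph (Fin (n + 1))}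
    (h : Noncrossing (edgesOf p σ G)) :
    Admissible (fun a b => visibilityNat p a b = σ) 0 n (edgesOf p σ G) := by
  refine ⟨?_, h⟩
  rintro e ⟨x, y, rfl, -, hv⟩
  exact ⟨(visibilityNat_coe x y).trans hv, Nat.zero_le _, Nat.lt_succ_iff.1 y.isLt⟩

/-- `chainGraph` and the two sets `edgesOf` translate between crossing-free graphs and pairs of
noncrossing sets, monotonically in both directions. So maximal graphs correspond to pairs of maximal
sets; a maximal graph contains all chain edges since adding them creates no crossing. -/
theorem triangulationCount_eq (hp : IsPointChain p) :
    triangulationCount p = maxCount (fun a b => visibilityNat p a b = 1) 0 n *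
      maxCount (fun a b => visibilityNat p a b = -1) 0 n := by
  have hround : ∀ S T, Admissible (fun a b => visibilityNat p a b = 1) 0 n S →
      Admissible (fun a b => visibilityNat p a b = -1) 0 n T →
      edgesOf p 1 (chainGraph n S T) = S ∧ edgesOf p (-1) (chainGraph n S T) = T :=
    fun S T hS hT => ⟨(edgesOf_chainGraph (Or.inl rfl) (fun e he => (hS.1 e he).1)
      (fun e he => (hT.1 e he).1)).1, (edgesOf_chainGraph (Or.inr rfl)
        (fun e he => (hT.1 e he).1) (fun e he => (hS.1 e he).1)).2⟩
  have hfree : ∀ S T, Admissible (fun a b => visibilityNat p a b = 1) 0 n S →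
      Admissible (fun a b => visibilityNat p a b = -1) 0 n T →
      CrossingFree p (chainGraph n S T) := by
    intro S T hS hT
    rw [crossingFree_iff hp, (hround S T hS hT).1, (hround S T hS hT).2]
    exact ⟨hS.2, hT.2⟩
  have himg : {G | IsTriangulation p G} =
      (fun q : Set (ℕ × ℕ) × Set (ℕ × ℕ) => chainGraph n q.1 q.2) ''
        (maxNoncrossing (fun a b => visibilityNat p a b = 1) 0 n ×ˢ
          maxNoncrossing (fun a b => visibilityNat p a b = -1) 0 n) := by
    ext G
    constructor
    · intro hG
      have h1 := (crossingFree_iff hp G).1 hG.1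
      have hu := admissible_edgesOf h1.1
      have hd := admissible_edgesOf h1.2
      have hle := le_chainGraph hp G
      refine ⟨(edgesOf p 1 G, edgesOf p (-1) G), ⟨⟨hu, fun S hS hSle => ?_⟩,
        ⟨hd, fun T hT hTle => ?_⟩⟩, le_antisymm (hG.2 (hfree _ _ hu hd) hle) hle⟩
      · have := hG.2 (hfree S _ hS hd) (hle.trans (chainGraph_mono hSle le_rfl))
        have := edgesOf_mono (p := p) (σ := 1) this
        rwa [(hround S _ hS hd).1] at this
      · have := hG.2 (hfree _ T hu hT) (hle.trans (chainGraph_mono le_rfl hTle))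
        have := edgesOf_mono (p := p) (σ := -1) this
        rwa [(hround _ T hu hT).2] at this
    · rintro ⟨⟨S, T⟩, ⟨hS, hT⟩, rfl⟩
      refine ⟨hfree S T hS.1 hT.1, fun G hG hle => ?_⟩
      have h1 := (crossingFree_iff hp G).1 hG
      have hr := hround S T hS.1 hT.1
      have h2 := edgesOf_mono (p := p) (σ := 1) hle
      have h3 := edgesOf_mono (p := p) (σ := -1) hle
      simp only at h2 h3
      rw [hr.1] at h2
      rw [hr.2] at h3
      exact (le_chainGraph hp G).trans (chainGraph_mono (hS.2 (admissible_edgesOf h1.1) h2)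
        (hT.2 (admissible_edgesOf h1.2) h3))
  have hinj : Set.InjOn (fun q : Set (ℕ × ℕ) × Set (ℕ × ℕ) => chainGraph n q.1 q.2)
        (maxNoncrossing (fun a b => visibilityNat p a b = 1) 0 n ×ˢ
          maxNoncrossing (fun a b => visibilityNat p a b = -1) 0 n) := by
    rintro ⟨S, T⟩ ⟨hS, hT⟩ ⟨S', T'⟩ ⟨hS', hT'⟩ heq
    simp only at heq
    have h1 := hround S T hS.1 hT.1
    have h2 := hround S' T' hS'.1 hT'.1
    rw [heq] at h1
    exact Prod.ext (h1.1.symm.trans h2.1) (h1.2.symm.trans h2.2)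
  rw [triangulationCount, himg, hinj.ncard_image, Set.ncard_prod]
  rfl

end Count

/-! ## Separable sign triangles -/

/-- The combinatorial properties of the visibility triangle of a chain: every nonadjacent pair has
a sign, and every interval can be split at a vertex such that all pairs separated by this vertex
have the same sign. -/
structure IsSeparableTriangle (n : ℕ) (V : ℕ → ℕ → ℤ) : Prop where
  zero : ∀ i j, j ≤ i + 1 → V i j = 0
  sign : ∀ i j, i + 1 < j → j ≤ n → V i j = 1 ∨ V i j = -1
  split : ∀ i j, i + 1 < j → j ≤ n → ∃ h, IsSplit (fun a b => V a b = V i j) i h j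

theorem IsPointChain.isSeparableTriangle {n : ℕ} {p : Fin (n + 1) → ℝ × ℝ} (hp : IsPointChain p) :
    IsSeparableTriangle n (visibilityNat p) where
  zero i j hij := by
    rw [visibilityNat]
    split_ifs with h
    · exact visibility_of_le hij
    · rfl
  sign i j hij hj := by
    rw [visibilityNat, dif_pos ⟨by omega, by omega⟩]
    exact visibility_eq_or hp hij
  split i j hij hj := by
    obtain ⟨h, h1, h2, h3⟩ := visibility_exists_split hp (i := ⟨i, by omega⟩) (j := ⟨j, by omega⟩)
      hij
    refine ⟨h, h1, h2, fun a b ha hah hhb hb => ?_⟩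
    have := h3 ⟨a, by omega⟩ ⟨b, by omega⟩ ha hah hhb hb
    rw [← visibilityNat_coe, ← visibilityNat_coe] at this
    exact this

namespace IsSeparableTriangle

variable {n : ℕ} {V : ℕ → ℕ → ℤ}

/-- A splitting vertex is recognized from row `i` alone: the last `h < j` for which `V i h` is not
`V i j`. Let `g` be the least splitting vertex. Edges from `i` beyond `g` pass over `g`, so `h ≤ g`.
If `h < g`, then `V i g = V i j`, and a splitting vertex of `[i, g]` would also split `[i, j]`,
contrary to the choice of `g`. -/
theorem isSplit_of_forall_gt (hV : IsSeparableTriangle n V) {i h j : ℕ} (hih : i < h) (hhj : h < j)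
    (hj : j ≤ n) (hh : V i h * V i j ≤ 0) (hgt : ∀ k, h < k → k < j → 0 < V i k * V i j) :
    IsSplit (fun a b => V a b = V i j) i h j := by
  classical
  have hex := hV.split i j (by omega) hj
  have hfind := Nat.find_spec hex
  have hmin := fun m => Nat.find_min hex (m := m)
  set g := Nat.find hex with hg
  obtain ⟨hig, hgj, hall⟩ := hfind
  have hsq : V i j * V i j = 1 := by
    rcases hV.sign i j (by omega) hj with h | h <;> rw [h] <;> norm_num
  have hhg : h ≤ g := by
    by_contra hc
    have := hall i h le_rfl hig (by omega) hhj.le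
    simp only at this
    rw [this, hsq] at hh
    omega
  rcases hhg.eq_or_lt with rfl | hlt
  · exact ⟨hih, hhj, hall⟩
  exfalso
  have hpos := hgt g hlt hgj
  have hne : V i g ≠ 0 := by intro h0; rw [h0, zero_mul] at hpos; exact lt_irrefl _ hpos
  have hig1 : i + 1 < g := by
    by_contra hc
    exact hne (hV.zero i g (by omega))
  have heq : V i g = V i j := by
    rcases hV.sign i g hig1 (by omega) with h1 | h1 <;>
      rcases hV.sign i j (by omega) hj with h2 | h2 <;> rw [h1, h2] at hpos <;> simp_all
  obtain ⟨g', h1, h2, h3⟩ := hV.split i g hig1 (by omega)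
  refine hmin g' h2 ⟨h1, by omega, fun a b ha hag hgb hb => ?_⟩
  rcases le_or_gt b g with hbg | hbg
  · exact (h3 a b ha hag hgb hbg).trans heq
  · exact hall a b ha (by omega) hbg hb

variable {σ : ℤ}

theorem skips (hV : IsSeparableTriangle n V) (hσ : σ = 1 ∨ σ = -1) : Skips fun a b => V a b = σ := by
  intro a b hab
  by_contra hc
  have := hV.zero a b (by omega)
  omega

theorem edgeWeight_eq_zero (hV : IsSeparableTriangle n V) (hσ : σ = 1 ∨ σ = -1) (a b : ℕ) (h : b ≤ a) :
    edgeWeight (fun a b => V a b = σ) a b = 0 := by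
  rw [edgeWeight, if_neg]
  rintro (h' | h')
  · omega
  · have := hV.skips hσ a b h'; omega

theorem pathWeight_leaf (hV : IsSeparableTriangle n V) (hσ : σ = 1 ∨ σ = -1) {i : ℕ} (hi : i + 1 ≤ n) :
    pathWeight (n + 1) (edgeWeight fun a b => V a b = σ) 1 i (i + 1) = 1 := by
  have : i + 1 < n + 1 := by omega
  simp [pathWeight, hi, edgeWeight, maxCount_succ (hV.skips hσ)]

/-- The indicator treats both signs by one formula without branching: if `V i j` is not `σ`, no edge
over `h` carries weight. -/
theorem passingWeight_node (hV : IsSeparableTriangle n V) (hσ : σ = 1 ∨ σ = -1) {i h j : ℕ} (hj : j ≤ n)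
    (hsp : IsSplit (fun a b => V a b = V i j) i h j) (u v : ℕ) :
    passingWeight (n + 1) (edgeWeight fun a b => V a b = σ) h j u v i =
      (if V i j = σ then 1 else 0) *
        (pathWeight (n + 1) (edgeWeight fun a b => V a b = σ) (u + 1) i h *
            pathWeight (n + 1) (edgeWeight fun a b => V a b = σ) (v + 1) h j +
          passingWeight (n + 1) (edgeWeight fun a b => V a b = σ) h j (u + 1) v i +
          passingWeight (n + 1) (edgeWeight fun a b => V a b = σ) h j u (v + 1) i) := by
  obtain ⟨hih, hhj, hall⟩ := hsp
  have hw := hV.edgeWeight_eq_zero hσ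
  split_ifs with hc
  · rw [one_mul]
    refine passingWeight_rec hw (by omega) (by omega) (fun a b ha hah hhb hb => ?_) u v
    have hab : V a b = σ := (hall a b ha hah hhb hb).trans hc
    rw [edgeWeight, if_pos (Or.inr hab)]
    rw [maxCount_eq_sum (hV.skips hσ) (h := h) ⟨hah, hhb, fun a' b' h1 h2 h3 h4 =>
      (hall a' b' (by omega) h2 h3 (by omega)).trans hc⟩]
    refine Finset.sum_subset (fun c hc => ?_) fun c _ hc => ?_
    · rw [Finset.mem_Ioo] at hc; rw [Finset.mem_range]; omega
    · rw [Finset.mem_Ioo] at hc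
      rcases Nat.lt_or_ge a c with h1 | h1
      · rw [hw c b (by omega), mul_zero]
      · rw [hw a c h1, zero_mul]
  · rw [zero_mul]
    refine Finset.sum_eq_zero fun a ha => Finset.sum_eq_zero fun b hb => ?_
    rw [Finset.mem_range] at ha
    rw [Finset.mem_Ico] at hb
    by_cases hia : i ≤ a
    · by_cases hbj : b ≤ j
      · rw [edgeWeight, if_neg, mul_zero, zero_mul]
        rintro (h1 | h1)
        · omega
        · exact hc ((hall a b hia ha hb.1 hbj).symm.trans h1)
      · rw [pathWeight_eq_zero hw (i := b) (j := j) (by omega), mul_zero]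
    · rw [pathWeight_eq_zero hw (i := i) (j := a) (by omega), zero_mul, zero_mul]

/-- The only path with a single edge over `h` is the edge `(i, j)`, so `D(0, 0)` is its weight. If
this edge has the other sign, that weight is `0` and the count is a product, which the path weights
do not show; therefore counts are stored separately. -/
theorem maxCount_node (hV : IsSeparableTriangle n V) (hσ : σ = 1 ∨ σ = -1) {i h j : ℕ} (hj : j ≤ n)
    (hsp : IsSplit (fun a b => V a b = V i j) i h j) :
    maxCount (fun a b => V a b = σ) i j =
      passingWeight (n + 1) (edgeWeight fun a b => V a b = σ) h j 0 0 i +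
        if V i j = σ then 0 else
          maxCount (fun a b => V a b = σ) i h * maxCount (fun a b => V a b = σ) h j := by
  obtain ⟨hih, hhj, hall⟩ := id hsp
  split_ifs with hc
  · rw [passingWeight_zero_left hih, Finset.sum_eq_single_of_mem j
      (Finset.mem_Ico.2 ⟨hhj, by omega⟩)]
    · simp [pathWeight, edgeWeight, hc]
    · intro b _ hb
      simp [pathWeight, hb]
  · rw [hV.passingWeight_node hσ hj hsp, if_neg hc, zero_mul, zero_add]
    exact maxCount_mul hih.le hhj.le (hV.skips hσ) fun a b ha hah hhb hb h =>
      hc ((hall a b ha hah hhb hb).symm.trans h)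

end IsSeparableTriangle

namespace RAM

/-! ## Reasoning about programs -/

theorem Memory.store_apply (s : Memory) (a : ℕ) (k z : ℤ) (b : ℕ) (m : ℤ) :
    s.store a k z b m = if b = a ∧ m = k then z else s b m := by
  unfold Memory.store
  by_cases h : b = a
  · subst h
    by_cases h' : m = k
    · subst h'; simp
    · simp [h']
  · simp [h]

/-- Started with memory `s`, the program halts after at most `B` steps, and `Q` holds then. -/
def Achieves (P : Program) (s : Memory) (B : ℕ) (Q : Memory → Prop) : Prop :=
  ∃ t s', Runs P s t s' ∧ t ≤ B ∧ Q s'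

theorem Achieves.weaken {P : Program} {s : Memory} {B B' : ℕ} {Q Q' : Memory → Prop}
    (h : Achieves P s B Q) (hB : B ≤ B') (hQ : ∀ s', Q s' → Q' s') : Achieves P s B' Q' := by
  obtain ⟨t, s', h1, h2, h3⟩ := h
  exact ⟨t, s', h1, h2.trans hB, hQ s' h3⟩

theorem Achieves.write {s : Memory} {B a : ℕ} {i e : Expr} {Q : Memory → Prop}
    (hB : i.cost + e.cost + 1 ≤ B) (h : Q (s.store a (i.eval s) (e.eval s))) :
    Achieves (.write a i e) s B Q :=
  ⟨_, _, .write s a i e, hB, h⟩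

theorem Achieves.seq {P P' : Program} {s : Memory} {B₁ B₂ B : ℕ} {Q Q' : Memory → Prop}
    (h : Achieves P s B₁ Q) (hB : B₁ + B₂ ≤ B) (h' : ∀ s', Q s' → Achieves P' s' B₂ Q') :
    Achieves (.seq P P') s B Q' := by
  obtain ⟨t, s', h1, h2, h3⟩ := h
  obtain ⟨t', s'', h4, h5, h6⟩ := h' s' h3
  exact ⟨_, _, .seq h1 h4, by omega, h6⟩

theorem Achieves.write_seq {P : Program} {s : Memory} {B a : ℕ} {i e : Expr}
    {Q : Memory → Prop} (hB : i.cost + e.cost + 1 ≤ B)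
    (h : Achieves P (s.store a (i.eval s) (e.eval s)) (B - (i.cost + e.cost + 1)) Q) :
    Achieves (.seq (.write a i e) P) s B Q :=
  Achieves.seq (Q := fun s' => s' = s.store a (i.eval s) (e.eval s)) (Achieves.write le_rfl rfl)
    (Nat.add_sub_cancel' hB).le fun _ hs' => hs' ▸ h

theorem Achieves.ifPos {P P' : Program} {e : Expr} {s : Memory} {B B' : ℕ} {Q : Memory → Prop}
    (hB : e.cost + 1 + B ≤ B') (h : 0 < e.eval s → Achieves P s B Q)
    (h' : e.eval s ≤ 0 → Achieves P' s B Q) : Achieves (.ifPos e P P') s B' Q := by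
  rcases lt_or_ge 0 (e.eval s) with he | he
  · obtain ⟨t, s', h1, h2, h3⟩ := h he
    exact ⟨_, s', .ifPos_pos he h1, by omega, h3⟩
  · obtain ⟨t, s', h1, h2, h3⟩ := h' he
    exact ⟨_, s', .ifPos_nonpos he h1, by omega, h3⟩

/-- The index of the invariant bounds the number of remaining iterations. -/
theorem Achieves.whilePos {P : Program} {e : Expr} {B : ℕ} {Q : Memory → Prop}
    (Inv : ℕ → Memory → Prop)
    (hInv : ∀ k s, Inv k s → (e.eval s ≤ 0 ∧ Q s) ∨
      (0 < e.eval s ∧ ∃ k', k = k' + 1 ∧ Achieves P s B (Inv k')))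
    {k : ℕ} {s : Memory} (h : Inv k s) :
    Achieves (.whilePos e P) s (k * (B + e.cost + 1) + e.cost + 1) Q := by
  induction k generalizing s with
  | zero =>
    rcases hInv 0 s h with h | ⟨-, k', hk', -⟩
    · exact ⟨_, s, .whilePos_nonpos h.1, by omega, h.2⟩
    · omega
  | succ k ih =>
    rcases hInv _ s h with h | ⟨he, k', hk', t, s', h1, h2, h3⟩
    · exact ⟨_, s, .whilePos_nonpos h.1, by omega, h.2⟩
    · obtain rfl : k = k' := by omega
      obtain ⟨t', s'', h4, h5, h6⟩ := ih h3
      refine ⟨_, s'', .whilePos_pos he h1 h4, ?_, h6⟩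
      rw [Nat.add_one_mul]
      omega

/-- Started with memory `s`, the loop reaches a memory with property `Q` at the end of one of its
iterations within `B` steps. -/
def Reaches (e : Expr) (P : Program) (s : Memory) (B : ℕ) (Q : Memory → Prop) : Prop :=
  ∃ t s', t ≤ B ∧ Q s' ∧ ∀ t' s'', Runs (.whilePos e P) s' t' s'' → Runs (.whilePos e P) s (t + t') s''

theorem Reaches.single {e : Expr} {P : Program} {s : Memory} {B B' : ℕ} {Q : Memory → Prop}
    (he : 0 < e.eval s) (hB : e.cost + 1 + B ≤ B') (h : Achieves P s B Q) :
    Reaches e P s B' Q := by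
  obtain ⟨t, s', h1, h2, h3⟩ := h
  exact ⟨e.cost + 1 + t, s', by omega, h3, fun t' s'' h4 => .whilePos_pos he h1 h4⟩

/-- This composes consecutive groups of iterations of one loop, as needed to follow a recursion that
is run by a single loop over a stack. -/
theorem Reaches.trans {e : Expr} {P : Program} {s : Memory} {B₁ B₂ B : ℕ} {Q Q' : Memory → Prop}
    (h : Reaches e P s B₁ Q) (hB : B₁ + B₂ ≤ B) (h' : ∀ s', Q s' → Reaches e P s' B₂ Q') :
    Reaches e P s B Q' := by
  obtain ⟨t, s', h1, h2, h3⟩ := h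
  obtain ⟨t', s'', h4, h5, h6⟩ := h' s' h2
  exact ⟨t + t', s'', by omega, h5, fun r x hx => by rw [add_assoc]; exact h3 _ _ (h6 _ _ hx)⟩

theorem Reaches.achieves {e : Expr} {P : Program} {s : Memory} {B B' : ℕ} {Q : Memory → Prop}
    (h : Reaches e P s B Q) (hB : B + e.cost + 1 ≤ B') (he : ∀ s', Q s' → e.eval s' ≤ 0) :
    Achieves (.whilePos e P) s B' Q := by
  obtain ⟨t, s', h1, h2, h3⟩ := h
  exact ⟨_, s', h3 _ _ (.whilePos_nonpos (he s' h2)), by omega, h2⟩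

/-! ## The program

The scalar variables are kept in cell `0` of an array of their own:
`n` in 0, the sign `σ` in 2, `N = n + 1` in 3, the stack pointer in 4, the interval `i`, `j` with
its splitting vertex `h` in 8, 9, 10, the counters `u`, `v` in 11, 12, the indicator of `V i j = σ`
in 16, a product in 17, and the count for `σ = 1` in 18. The stack of intervals is in the arrays
5, 6, 7, where splitting vertex `0` marks an interval that has not been split yet. Array 13 is a
row of passing weights, array 14 contains the path weights of intervals, and array 15 the numbers
of maximal noncrossing sets. -/

/-- The scalar variable in cell `0` of array `a`. -/
abbrev Expr.var (a : ℕ) : Expr := .read a (.const 0)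

/-- Assignment to the scalar variable in cell `0` of array `a`. -/
abbrev Program.assign (a : ℕ) (e : Expr) : Program := .write a (.const 0) e

/-- Difference of two expressions. -/
abbrev Expr.sub (x y : Expr) : Expr := .add x (.mul (.const (-1)) y)

/-- Index of an entry that belongs to the interval from `x` to `y`. -/
abbrev Expr.pair (x y : Expr) : Expr := .add (.mul x (.var 3)) y

/-- Index of entry `k` of the array that belongs to the interval from `x` to `y`. -/
abbrev Expr.triple (x y k : Expr) : Expr := .pair (.pair x y) k

/-- The path weight for paths with `k` edges from `x` to `y`. -/
abbrev Expr.weight (x y k : Expr) : Expr := .read 14 (.triple x y k)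

/-- Treat one pair of path lengths in a merge. -/
def mergeCell : Program :=
  .seq (.assign 17 (.mul (.weight (.var 8) (.var 10) (.var 11))
      (.weight (.var 10) (.var 9) (.var 12)))) <|
  .seq (.write 13 (.sub (.var 12) (.const 1)) (.mul (.var 16) (.add (.var 17)
      (.add (.read 13 (.sub (.var 12) (.const 1))) (.read 13 (.var 12)))))) <|
  .seq (.write 14 (.triple (.var 8) (.var 9) (.add (.var 11) (.var 12)))
      (.add (.weight (.var 8) (.var 9) (.add (.var 11) (.var 12))) (.var 17))) <|
  .seq (.write 14 (.triple (.var 8) (.var 9) (.sub (.add (.var 11) (.var 12)) (.const 1)))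
      (.add (.weight (.var 8) (.var 9) (.sub (.add (.var 11) (.var 12)) (.const 1)))
        (.read 13 (.sub (.var 12) (.const 1))))) <|
  .assign 12 (.sub (.var 12) (.const 1))

/-- Treat one path length on the left in a merge. -/
def mergeRow : Program :=
  .seq (.assign 12 (.sub (.var 9) (.var 10))) <|
  .seq (.whilePos (.var 12) mergeCell) <|
  .assign 11 (.sub (.var 11) (.const 1))

/-- Initialize the arrays for a merge. -/
def mergeClear : Program :=
  .seq (.assign 11 (.add (.sub (.var 9) (.var 8)) (.const 1))) <|
  .whilePos (.var 11) <|
    .seq (.assign 11 (.sub (.var 11) (.const 1))) <|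
    .seq (.write 13 (.var 11) (.const 0)) <|
    .write 14 (.triple (.var 8) (.var 9) (.var 11)) (.const 0)

/-- The indicator of `V i j = σ`. -/
def mergeSign : Program :=
  .ifPos (.mul (.read 1 (.pair (.var 8) (.var 9))) (.var 2))
    (.assign 16 (.const 1)) (.assign 16 (.const 0))

/-- Compute the results for the interval from `i` to `j` from those for the intervals from `i` to
`h` and from `h` to `j`. -/
def merge : Program :=
  .seq mergeClear <|
  .seq mergeSign <|
  .seq (.assign 11 (.sub (.var 10) (.var 8))) <|
  .seq (.whilePos (.var 11) mergeRow) <|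
  .write 15 (.pair (.var 8) (.var 9)) (.add (.read 13 (.const 0))
    (.mul (.sub (.const 1) (.var 16))
      (.mul (.read 15 (.pair (.var 8) (.var 10))) (.read 15 (.pair (.var 10) (.var 9))))))

/-- Find the splitting vertex of the interval from `i` to `j`. -/
def scan : Program :=
  .seq (.assign 10 (.sub (.var 9) (.const 1))) <|
  .whilePos (.mul (.read 1 (.pair (.var 8) (.var 10))) (.read 1 (.pair (.var 8) (.var 9)))) <|
    .assign 10 (.sub (.var 10) (.const 1))

/-- Push an interval with its splitting vertex to the stack. -/
def push (x y z : Expr) : Program :=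
  .seq (.assign 4 (.add (.var 4) (.const 1))) <|
  .seq (.write 5 (.var 4) x) <|
  .seq (.write 6 (.var 4) y) <|
  .write 7 (.var 4) z

/-- Split the interval from `i` to `j`. -/
def visit : Program :=
  .seq scan <|
  .seq (push (.var 8) (.var 9) (.var 10)) <|
  .seq (push (.var 8) (.var 10) (.const 0)) <|
  push (.var 10) (.var 9) (.const 0)

/-- Treat an interval that consists of a single chain edge. -/
def leaf : Program :=
  .seq (.write 14 (.triple (.var 8) (.var 9) (.const 1)) (.const 1)) <|
  .write 15 (.pair (.var 8) (.var 9)) (.const 1)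

/-- Pop an interval from the stack. -/
def pop : Program :=
  .seq (.assign 8 (.read 5 (.var 4))) <|
  .seq (.assign 9 (.read 6 (.var 4))) <|
  .seq (.assign 10 (.read 7 (.var 4))) <|
  .assign 4 (.sub (.var 4) (.const 1))

/-- Treat the interval on top of the stack. -/
def step : Program :=
  .seq pop <|
  .ifPos (.var 10) merge <|
  .ifPos (.sub (.sub (.var 9) (.var 8)) (.const 1)) visit leaf

/-- Compute the number of maximal noncrossing sets of edges with sign `σ`. -/
def countSign : Program :=
  .seq (.assign 4 (.const 0)) <|
  .seq (push (.const 0) (.var 0) (.const 0)) <|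
  .whilePos (.var 4) step

/-- Compute the number of triangulations of a chain from its visibility triangle. -/
def countTriangulations : Program :=
  .seq (.assign 3 (.add (.var 0) (.const 1))) <|
  .seq (.assign 2 (.const 1)) <|
  .seq countSign <|
  .seq (.assign 18 (.read 15 (.var 0))) <|
  .seq (.assign 2 (.const (-1))) <|
  .seq countSign <|
  .assign 0 (.mul (.var 18) (.read 15 (.var 0)))

end RAM

namespace RAM

/-! ## Correctness of the program -/

/-- Index of the entry that belongs to the interval from `i` to `j`. -/
def pairIndex (n i j : ℕ) : ℤ := (i : ℤ) * ((n : ℤ) + 1) + j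

/-- Index of entry `k` of the array that belongs to the interval from `i` to `j`. -/
def tripleIndex (n i j k : ℕ) : ℤ := ((i : ℤ) * ((n : ℤ) + 1) + j) * ((n : ℤ) + 1) + k

theorem pairIndex_inj {n i j a b : ℕ} (hj : j ≤ n) (hb : b ≤ n)
    (h : pairIndex n i j = pairIndex n a b) : i = a ∧ j = b := by
  have h' : j + (n + 1) * i = b + (n + 1) * a := by
    simp only [pairIndex] at h
    zify; linarith
  have h1 := congrArg (· / (n + 1)) h'
  have h2 := congrArg (· % (n + 1)) h'
  simp only [Nat.add_mul_div_left _ _ n.succ_pos, Nat.add_mul_mod_self_left] at h1 h2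
  rw [Nat.div_eq_of_lt (by omega), Nat.div_eq_of_lt (by omega)] at h1
  rw [Nat.mod_eq_of_lt (by omega), Nat.mod_eq_of_lt (by omega)] at h2
  omega

/-- The index is a number written in base `n + 1`; two applications of `pairIndex_inj` recover its
digits. -/
theorem tripleIndex_inj {n i j k a b c : ℕ} (hj : j ≤ n) (hb : b ≤ n) (hk : k ≤ n) (hc : c ≤ n)
    (h : tripleIndex n i j k = tripleIndex n a b c) : i = a ∧ j = b ∧ k = c := by
  have h' : pairIndex n (i * (n + 1) + j) k = pairIndex n (a * (n + 1) + b) c := by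
    simp only [tripleIndex, pairIndex] at h ⊢
    push_cast; exact h
  obtain ⟨h1, h2⟩ := pairIndex_inj hk hc h'
  obtain ⟨h3, h4⟩ := pairIndex_inj (n := n) (i := i) (a := a) hj hb (by
    simp only [pairIndex]; exact_mod_cast h1)
  exact ⟨h3, h4, h2⟩

/-- The counters hold `u + 1` and `v + 1` for the pair `u = k`, `v = m`: a loop stops when its
counter reaches `0`, and the counters are directly the path lengths to look up. -/
theorem mergeCell_achieves {s : Memory} {n i h j k m : ℕ} (h3 : s 3 0 = (n : ℤ) + 1)
    (h8 : s 8 0 = i) (h9 : s 9 0 = j) (h10 : s 10 0 = h) (h11 : s 11 0 = (k : ℤ) + 1)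
    (h12 : s 12 0 = (m : ℤ) + 1) {A E : ℤ}
    (hA : A = s 14 (tripleIndex n i h (k + 1)) * s 14 (tripleIndex n h j (m + 1)))
    (hE : E = s 16 0 * (A + (s 13 m + s 13 ((m : ℤ) + 1)))) :
    Achieves mergeCell s 200 fun s' => s' 12 0 = m ∧
      (∀ z, s' 13 z = if z = m then E else s 13 z) ∧
      (∀ z, s' 14 z = if z = tripleIndex n i j (k + m + 1) then s 14 z + E else
        if z = tripleIndex n i j (k + m + 2) then s 14 z + A else s 14 z) ∧
      ∀ a z, a ≠ 12 → a ≠ 13 → a ≠ 14 → a ≠ 17 → s' a z = s a z := by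
  have e1 : ((i : ℤ) * ((n : ℤ) + 1) + h) * ((n : ℤ) + 1) + ((k : ℤ) + 1) =
      tripleIndex n i h (k + 1) := by simp [tripleIndex]
  have e2 : ((h : ℤ) * ((n : ℤ) + 1) + j) * ((n : ℤ) + 1) + ((m : ℤ) + 1) =
      tripleIndex n h j (m + 1) := by simp [tripleIndex]
  have e3 : ((i : ℤ) * ((n : ℤ) + 1) + j) * ((n : ℤ) + 1) + ((k : ℤ) + 1 + ((m : ℤ) + 1)) =
      tripleIndex n i j (k + m + 2) := by simp [tripleIndex]; ring
  have e4 : ((i : ℤ) * ((n : ℤ) + 1) + j) * ((n : ℤ) + 1) + ((k : ℤ) + 1 + ((m : ℤ) + 1) + -1) =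
      tripleIndex n i j (k + m + 1) := by simp [tripleIndex]; ring
  have e5 : (m : ℤ) + 1 + -1 = m := by ring
  -- The two updated cells differ, so the second update does not read the result of the first.
  have e6 : tripleIndex n i j (k + m + 1) ≠ tripleIndex n i j (k + m + 2) := by
    simp [tripleIndex]
  unfold mergeCell
  iterate 4 refine Achieves.write_seq (by decide) ?_
  refine Achieves.write (by decide) ?_
  simp only [Expr.eval, Memory.store_apply, h3, h8, h9, h10, h11, h12, e1, e2, e3, ← hA,
    Nat.reduceEqDiff, false_and, true_and, and_self, if_true, if_false, neg_one_mul, e4, e5, ← hE,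
    e6]
  refine ⟨fun _ => trivial, fun z => ?_, fun a z h1 h2 h3 h4 => ?_⟩
  · split_ifs with h1 h2
    · rw [h1]
    · rw [h2]
    · rfl
  · simp only [h1, h2, h3, h4, false_and, if_false]

/-- The contribution of a pair of path lengths to the number of paths with `r` edges. -/
def contribution (L R : ℕ → ℤ) (D : ℕ → ℕ → ℤ) (r u v : ℕ) : ℤ :=
  (if u + v + 2 = r then L u * R v else 0) + if u + v + 1 = r then D u v else 0

/-- What does not change during the loops of a merge: `s₀` is the memory at the beginning. -/
structure MergeFrame (n i j : ℕ) (s₀ s : Memory) : Prop where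
  agree : ∀ a ∉ ({11, 12, 13, 14, 17} : Finset ℕ), ∀ z, s a z = s₀ a z
  other : ∀ z, (∀ k : ℕ, k ≤ j - i → z ≠ tripleIndex n i j k) → s 14 z = s₀ 14 z

/-- The data for a merge: `L` and `R` are the path weights on the left and on the right, and `D`
are the passing weights. -/
structure MergeData (n i h j : ℕ) (L R : ℕ → ℤ) (D : ℕ → ℕ → ℤ) (s : Memory) : Prop where
  i_lt : i < h
  lt_j : h < j
  j_le : j ≤ n
  mem3 : s 3 0 = (n : ℤ) + 1
  mem8 : s 8 0 = i
  mem9 : s 9 0 = j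
  mem10 : s 10 0 = h
  left : ∀ u < h - i, s 14 (tripleIndex n i h (u + 1)) = L u
  right : ∀ v < j - h, s 14 (tripleIndex n h j (v + 1)) = R v
  step : ∀ u v, D u v = s 16 0 * (L u * R v + (D u (v + 1) + D (u + 1) v))
  zero : ∀ u v, h - i ≤ u ∨ j - h ≤ v → D u v = 0

section Merge

variable {n i h j : ℕ} {L R : ℕ → ℤ} {D : ℕ → ℕ → ℤ} {s₀ : Memory}

/-- Invariant of the inner loop of a merge. -/
structure CellInv (n i h j : ℕ) (L R : ℕ → ℤ) (D : ℕ → ℕ → ℤ) (s₀ : Memory) (k m : ℕ)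
    (s : Memory) : Prop where
  frame : MergeFrame n i j s₀ s
  m_le : m ≤ j - h
  mem11 : s 11 0 = (k : ℤ) + 1
  mem12 : s 12 0 = m
  row_lt : ∀ v < m, s 13 v = D (k + 1) v
  row_ge : ∀ v, m ≤ v → v ≤ j - h → s 13 v = D k v
  weight : ∀ r, 1 ≤ r → r ≤ j - i → s 14 (tripleIndex n i j r) =
    ∑ u ∈ Finset.Ico (k + 1) (h - i), ∑ v ∈ Finset.range (j - h), contribution L R D r u v +
      ∑ v ∈ Finset.Ico m (j - h), contribution L R D r k v

/-- Invariant of the outer loop of a merge. -/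
structure RowInv (n i h j : ℕ) (L R : ℕ → ℤ) (D : ℕ → ℕ → ℤ) (s₀ : Memory) (k : ℕ)
    (s : Memory) : Prop where
  frame : MergeFrame n i j s₀ s
  k_le : k ≤ h - i
  mem11 : s 11 0 = k
  row : ∀ v ≤ j - h, s 13 v = D k v
  weight : ∀ r, 1 ≤ r → r ≤ j - i → s 14 (tripleIndex n i j r) =
    ∑ u ∈ Finset.Ico k (h - i), ∑ v ∈ Finset.range (j - h), contribution L R D r u v

/-- One row of `D` suffices. With `v` decreasing, cell `m` still holds `D (k + 1) m` while cell `m +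
1` already holds `D k (m + 1)`, the two values in the recursion for `D k m`. -/
theorem CellInv.achieves (hd : MergeData n i h j L R D s₀) {k m : ℕ} (hk : k < h - i) {s : Memory}
    (hs : CellInv n i h j L R D s₀ k (m + 1) s) :
    Achieves mergeCell s 200 (CellInv n i h j L R D s₀ k m) := by
  obtain ⟨hih, hhj, hjn, h3, h8, h9, h10, hL, hR, hstep, hzero⟩ := hd
  obtain ⟨hf, hm, h11, h12, hlt, hge, hw⟩ := hs
  -- The results for the two subintervals are in cells that this merge does not change.
  have hA : L k * R m = s 14 (tripleIndex n i h (k + 1)) * s 14 (tripleIndex n h j (m + 1)) := by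
    rw [hf.other, hf.other, hL k hk, hR m (by omega)]
    · intro l hl h
      have := tripleIndex_inj (by omega) (by omega) (by omega) (by omega) h
      omega
    · intro l hl h
      have := tripleIndex_inj (by omega) (by omega) (by omega) (by omega) h
      omega
  have hE : D k m = s 16 0 * (L k * R m + (s 13 m + s 13 ((m : ℤ) + 1))) := by
    rw [hf.agree 16 (by decide), hlt m (by omega)]
    have := hge (m + 1) le_rfl hm
    push_cast at this
    rw [this, hstep k m]
    ring
  refine (mergeCell_achieves (n := n) (i := i) (h := h) (j := j) (k := k) (m := m)
    (by rw [hf.agree 3 (by decide), h3]) (by rw [hf.agree 8 (by decide), h8])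
    (by rw [hf.agree 9 (by decide), h9]) (by rw [hf.agree 10 (by decide), h10]) h11
    (by rw [h12]; push_cast; rfl) hA hE).weaken le_rfl ?_
  rintro s' ⟨g12, g13, g14, g⟩
  refine ⟨⟨fun a ha z => ?_, fun z hz => ?_⟩, by omega, ?_, g12, fun v hv => ?_,
    fun v hv hv' => ?_, fun r hr hr' => ?_⟩
  · have ha' := ha
    simp only [Finset.mem_insert, Finset.mem_singleton, not_or] at ha'
    rw [g a z ha'.2.1 ha'.2.2.1 ha'.2.2.2.1 ha'.2.2.2.2, hf.agree a ha]
  · rw [g14, if_neg (hz _ (by omega)), if_neg (hz _ (by omega)), hf.other z hz]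
  · rw [g 11 0 (by decide) (by decide) (by decide) (by decide), h11]
  · rw [g13, if_neg (by omega), hlt v (by omega)]
  · rw [g13]
    split_ifs with h
    · rw [show v = m by omega]
    · exact hge v (by omega) hv'
  · have hinj : ∀ l, l ≤ n → (tripleIndex n i j r = tripleIndex n i j l ↔ r = l) := fun l hl =>
      ⟨fun h => (tripleIndex_inj hjn hjn (by omega) hl h).2.2, fun h => by rw [h]⟩
    have e1 := hinj (k + m + 1) (by omega)
    have e2 := hinj (k + m + 2) (by omega)
    simp only [g14, e1, e2]
    rw [Finset.sum_eq_sum_Ico_succ_bot (by omega : m < j - h), hw r hr hr']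
    simp only [contribution]
    rcases Nat.lt_trichotomy r (k + m + 1) with h | h | h
    · rw [if_neg (by omega), if_neg (by omega), if_neg (by omega), if_neg (by omega)]
      ring
    · rw [if_pos h, if_neg (by omega), if_pos h.symm]
      ring
    · rw [if_neg (by omega)]
      by_cases h' : r = k + m + 2
      · rw [if_pos h', if_pos h'.symm, if_neg (by omega)]
        ring
      · rw [if_neg h', if_neg (by omega), if_neg (by omega)]
        ring

theorem RowInv.achieves (hd : MergeData n i h j L R D s₀) {k : ℕ} {s : Memory}
    (hs : RowInv n i h j L R D s₀ (k + 1) s) :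
    Achieves mergeRow s (203 * (j - h) + 50) (RowInv n i h j L R D s₀ k) := by
  obtain ⟨hf, hk, h11, hrow, hw⟩ := hs
  have hinit : CellInv n i h j L R D s₀ k (j - h) (s.store 12 0 ((j : ℤ) - h)) := by
    refine ⟨⟨fun a ha z => ?_, fun z hz => ?_⟩, le_rfl, ?_, ?_, fun v hv => ?_, fun v hv hv' => ?_,
      fun r hr hr' => ?_⟩
    · have ha' := ha
      simp only [Finset.mem_insert, Finset.mem_singleton, not_or] at ha'
      simp only [Memory.store_apply, ha'.2.1, false_and, if_false]
      exact hf.agree a ha z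
    · simp only [Memory.store_apply, Nat.reduceEqDiff, false_and, if_false]
      exact hf.other z hz
    · simp only [Memory.store_apply, Nat.reduceEqDiff, false_and, if_false, h11]
      push_cast; rfl
    · simp only [Memory.store_apply, and_self, if_true]
      rw [Nat.cast_sub hd.lt_j.le]
    · simp only [Memory.store_apply, Nat.reduceEqDiff, false_and, if_false]
      exact hrow v (by omega)
    · simp only [Memory.store_apply, Nat.reduceEqDiff, false_and, if_false]
      -- Only the boundary cell `v = j - h` is concerned; it is never overwritten and holds `0` in
      -- every row.
      rw [hrow v hv', hd.zero _ _ (Or.inr hv), hd.zero _ _ (Or.inr hv)]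
    · simp only [Memory.store_apply, Nat.reduceEqDiff, false_and, if_false]
      rw [hw r hr hr', Finset.Ico_self, Finset.sum_empty, add_zero]
  unfold mergeRow
  refine Achieves.write_seq (by simp only [Expr.cost]; omega) ?_
  have e : Expr.eval s ((Expr.var 9).sub (.var 10)) = (j : ℤ) - h := by
    simp only [Expr.eval, hf.agree 9 (by decide), hf.agree 10 (by decide), hd.mem9, hd.mem10]
    ring
  rw [e]
  have hloop := Achieves.whilePos (P := mergeCell) (e := .var 12) (B := 200)
    (Q := CellInv n i h j L R D s₀ k 0) (CellInv n i h j L R D s₀ k) (fun m s hs => by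
      cases m with
      | zero => left; exact ⟨by simp only [Expr.eval, hs.mem12]; rfl, hs⟩
      | succ m =>
        right
        exact ⟨by simp only [Expr.eval, hs.mem12]; omega, m, rfl, hs.achieves hd (by omega)⟩) hinit
  refine hloop.seq (B₂ := 10) (by simp only [Expr.cost]; omega) fun s' hs' => ?_
  obtain ⟨gf, -, g11, -, -, gge, gw⟩ := hs'
  refine Achieves.write (by decide) ?_
  simp only [Expr.eval]
  refine ⟨⟨fun a ha z => ?_, fun z hz => ?_⟩, by omega, ?_, fun v hv => ?_, fun r hr hr' => ?_⟩
  · have ha' := ha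
    simp only [Finset.mem_insert, Finset.mem_singleton, not_or] at ha'
    simp only [Memory.store_apply, ha'.1, false_and, if_false]
    exact gf.agree a ha z
  · simp only [Memory.store_apply, Nat.reduceEqDiff, false_and, if_false]
    exact gf.other z hz
  · simp only [Memory.store_apply, and_self, if_true, g11]
    ring
  · simp only [Memory.store_apply, Nat.reduceEqDiff, false_and, if_false]
    exact gge v (Nat.zero_le _) hv
  · simp only [Memory.store_apply, Nat.reduceEqDiff, false_and, if_false]
    rw [gw r hr hr', Finset.sum_eq_sum_Ico_succ_bot (by omega : k < h - i), Finset.range_eq_Ico,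
      add_comm]

theorem mergeRows_achieves (hd : MergeData n i h j L R D s₀) {s : Memory}
    (hs : RowInv n i h j L R D s₀ (h - i) s) :
    Achieves (.whilePos (.var 11) mergeRow) s ((h - i) * (203 * (j - h) + 53) + 3)
      (RowInv n i h j L R D s₀ 0) := by
  refine (Achieves.whilePos (B := 203 * (j - h) + 50) (RowInv n i h j L R D s₀)
    (fun m s hs => ?_) hs).weaken (by simp only [Expr.cost]; exact le_of_eq (by ring)) fun _ h => h
  cases m with
  | zero => left; exact ⟨by simp only [Expr.eval, hs.mem11]; rfl, hs⟩
  | succ m =>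
    right
    exact ⟨by simp only [Expr.eval, hs.mem11]; omega, m, rfl, hs.achieves hd⟩

theorem mergeClear_achieves {s : Memory} (hij : i ≤ j) (hj : j ≤ n) (h3 : s 3 0 = (n : ℤ) + 1)
    (h8 : s 8 0 = i) (h9 : s 9 0 = j) :
    Achieves mergeClear s (100 * (j - i + 1) + 50) fun s' => MergeFrame n i j s s' ∧
      ∀ v ≤ j - i, s' 13 v = 0 ∧ s' 14 (tripleIndex n i j v) = 0 := by
  unfold mergeClear
  refine Achieves.write_seq (by simp only [Expr.cost]; omega) ?_
  have hloop := Achieves.whilePos (e := .var 11) (B := 90)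
    (P := .seq (.assign 11 (.sub (.var 11) (.const 1))) <|
      .seq (.write 13 (.var 11) (.const 0)) <|
      .write 14 (.triple (.var 8) (.var 9) (.var 11)) (.const 0))
    (Q := fun s' => MergeFrame n i j s s' ∧
      ∀ v ≤ j - i, s' 13 v = 0 ∧ s' 14 (tripleIndex n i j v) = 0)
    (fun k s' => s' 11 0 = k ∧ k ≤ j - i + 1 ∧ MergeFrame n i j s s' ∧
      ∀ v, k ≤ v → v ≤ j - i → s' 13 v = 0 ∧ s' 14 (tripleIndex n i j v) = 0)
    (k := j - i + 1)
    (s := s.store 11 ((Expr.const 0).eval s)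
      (Expr.eval s (((Expr.var 9).sub (.var 8)).add (.const 1)))) (fun k s' hs => ?_) ?_
  · refine hloop.weaken ?_ fun _ h => h
    simp only [Expr.cost]
    omega
  · obtain ⟨g11, hk, hf, hz⟩ := hs
    cases k with
    | zero =>
      left
      exact ⟨by simp only [Expr.eval, g11]; rfl, hf, fun v hv => hz v (Nat.zero_le _) hv⟩
    | succ k =>
      right
      refine ⟨by simp only [Expr.eval, g11]; omega, k, rfl, ?_⟩
      iterate 2 refine Achieves.write_seq (by decide) ?_
      refine Achieves.write (by decide) ?_
      have g3 : s' 3 0 = (n : ℤ) + 1 := by rw [hf.agree 3 (by decide), h3]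
      have g8 : s' 8 0 = i := by rw [hf.agree 8 (by decide), h8]
      have g9 : s' 9 0 = j := by rw [hf.agree 9 (by decide), h9]
      have e1 : ((k + 1 : ℕ) : ℤ) + -1 = k := by push_cast; ring
      have e2 : ((i : ℤ) * ((n : ℤ) + 1) + j) * ((n : ℤ) + 1) + k = tripleIndex n i j k := rfl
      simp only [Expr.eval, Memory.store_apply, g3, g8, g9, g11, Nat.reduceEqDiff, false_and,
        true_and, and_self, if_true, if_false, neg_one_mul, e1, e2]
      refine ⟨by omega, ⟨fun a ha z => ?_, fun z hz' => ?_⟩, fun v hv hv' => ?_⟩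
      · have ha' := ha
        simp only [Finset.mem_insert, Finset.mem_singleton, not_or] at ha'
        simp only [Memory.store_apply, ha'.1, ha'.2.2.1, ha'.2.2.2.1, false_and, if_false]
        exact hf.agree a ha z
      · simp only [Memory.store_apply, Nat.reduceEqDiff, false_and, true_and, if_false,
          hz' k (by omega)]
        exact hf.other z hz'
      · rcases hv.eq_or_lt with rfl | hv
        · simp
        · have h1 : ¬ (v : ℤ) = k := by omega
          have h2 : ¬ tripleIndex n i j v = tripleIndex n i j k := fun h =>
            hv.ne' (tripleIndex_inj hj hj (by omega) (by omega) h).2.2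
          simp only [h1, h2, if_false]
          exact hz v hv hv'
  · refine ⟨?_, le_rfl, ⟨fun a ha z => ?_, fun z hz => ?_⟩, fun v hv hv' => by omega⟩
    · simp only [Memory.store_apply, Expr.eval, h8, h9, and_self, if_true]
      push_cast [Nat.cast_sub hij]
      ring
    · simp only [Finset.mem_insert, Finset.mem_singleton, not_or] at ha
      simp only [Memory.store_apply, ha.1, false_and, if_false]
    · simp only [Memory.store_apply, Nat.reduceEqDiff, false_and, if_false]

end Merge

end RAM

namespace RAM

/-! ### Solving one interval: leaf, scan and merge -/

section Node

variable {n : ℕ} {V : ℕ → ℕ → ℤ} {σ : ℤ} {i h j : ℕ} {s : Memory}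

/-- The memory contains the input for counting the sets of edges with sign `σ`. -/
structure HasInput (n : ℕ) (V : ℕ → ℕ → ℤ) (σ : ℤ) (s : Memory) : Prop where
  mem0 : s 0 0 = n
  mem1 : ∀ i j, i ≤ n → j ≤ n → s 1 (pairIndex n i j) = V i j
  mem2 : s 2 0 = σ
  mem3 : s 3 0 = (n : ℤ) + 1

/-- The memory contains the results for the interval from `i` to `j`. -/
structure IsSolved (n : ℕ) (V : ℕ → ℕ → ℤ) (σ : ℤ) (s : Memory) (i j : ℕ) : Prop where
  weight : ∀ k, 1 ≤ k → k ≤ j - i → s 14 (tripleIndex n i j k) =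
    pathWeight (n + 1) (edgeWeight fun a b => V a b = σ) k i j
  count : s 15 (pairIndex n i j) = maxCount (fun a b => V a b = σ) i j

/-- The interval from `i` to `j` has been solved and no result was lost: `s` is the memory at the
beginning. -/
structure Solves (n : ℕ) (V : ℕ → ℕ → ℤ) (σ : ℤ) (s : Memory) (i j : ℕ) (s' : Memory) :
    Prop where
  agree : ∀ a ∉ ({11, 12, 13, 14, 15, 16, 17} : Finset ℕ), ∀ z, s' a z = s a z
  keep : ∀ a b, b ≤ n → IsSolved n V σ s a b → IsSolved n V σ s' a b
  solved : IsSolved n V σ s' i j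

/-- Different intervals have disjoint cells, so overwriting those of `[i, j]` leaves all other
results intact. -/
theorem IsSolved.keep {s' : Memory} (hj : j ≤ n) (hs' : IsSolved n V σ s' i j)
    (h14 : ∀ z, (∀ k : ℕ, k ≤ j - i → z ≠ tripleIndex n i j k) → s' 14 z = s 14 z)
    (h15 : ∀ z, z ≠ pairIndex n i j → s' 15 z = s 15 z) (a b : ℕ) (hb : b ≤ n)
    (hs : IsSolved n V σ s a b) : IsSolved n V σ s' a b := by
  by_cases hab : a = i ∧ b = j
  · rw [hab.1, hab.2]; exact hs'
  refine ⟨fun k hk hk' => ?_, ?_⟩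
  · rw [h14, hs.weight k hk hk']
    intro l hl h
    have := tripleIndex_inj hb hj (by omega) (by omega) h
    exact hab ⟨this.1, this.2.1⟩
  · rw [h15, hs.count]
    intro h
    exact hab (pairIndex_inj hb hj h)

theorem mergeSign_achieves (hV : IsSeparableTriangle n V) (hσ : σ = 1 ∨ σ = -1)
    (hs : HasInput n V σ s) (hij : i + 1 < j) (hj : j ≤ n) (h8 : s 8 0 = i) (h9 : s 9 0 = j) :
    Achieves mergeSign s 50 fun s' => s' = s.store 16 0 (if V i j = σ then 1 else 0) := by
  have e1 := hs.mem1 i j (by omega) hj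
  rw [pairIndex] at e1
  have hsign := hV.sign i j hij hj
  refine Achieves.ifPos (B := 10) (by decide) (fun he => ?_) fun he => ?_
  · simp only [Expr.eval, h8, h9, hs.mem3, hs.mem2, e1] at he
    have : V i j = σ := by
      rcases hsign with h1 | h1 <;> rcases hσ with h2 | h2 <;> rw [h1, h2] at he ⊢ <;>
        norm_num at he
    rw [if_pos this]
    exact Achieves.write (by decide) rfl
  · simp only [Expr.eval, h8, h9, hs.mem3, hs.mem2, e1] at he
    have : V i j ≠ σ := by
      rcases hsign with h1 | h1 <;> rcases hσ with h2 | h2 <;> rw [h1, h2] at he ⊢ <;>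
        first | (norm_num; done) | exact absurd he (by norm_num)
    rw [if_neg this]
    exact Achieves.write (by decide) rfl

theorem merge_achieves (hV : IsSeparableTriangle n V) (hσ : σ = 1 ∨ σ = -1)
    (hs : HasInput n V σ s) (hj : j ≤ n) (hsp : IsSplit (fun a b => V a b = V i j) i h j)
    (h8 : s 8 0 = i) (h9 : s 9 0 = j) (h10 : s 10 0 = h) (hl : IsSolved n V σ s i h)
    (hr : IsSolved n V σ s h j) :
    Achieves merge s (1000 * ((h - i) * (j - h))) (Solves n V σ s i j) := by
  obtain ⟨hih, hhj, -⟩ := id hsp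
  have hw := hV.edgeWeight_eq_zero hσ
  -- As both factors are at least `1`, linear and constant costs are absorbed by the product.
  have hpq : (h - i) + (j - h) ≤ 2 * ((h - i) * (j - h)) := by
    obtain ⟨p, hp⟩ : ∃ p, h - i = p + 1 := ⟨h - i - 1, by omega⟩
    obtain ⟨q, hq⟩ : ∃ q, j - h = q + 1 := ⟨j - h - 1, by omega⟩
    rw [hp, hq]; nlinarith [Nat.zero_le (p * q)]
  have hp1 : 1 ≤ (h - i) * (j - h) := Nat.mul_pos (by omega) (by omega)
  have hmul : (h - i) * (203 * (j - h) + 53) ≤ 256 * ((h - i) * (j - h)) := by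
    have : (h - i) * 53 ≤ 53 * ((h - i) * (j - h)) := by
      nlinarith [Nat.le_mul_of_pos_right (h - i) (show 0 < j - h by omega)]
    nlinarith
  unfold merge
  refine (mergeClear_achieves (i := i) (j := j) (by omega) hj hs.mem3 h8 h9).seq
    (B₂ := 256 * ((h - i) * (j - h)) + 203) (by omega) fun s₁ ⟨f1, z1⟩ => ?_
  have ag1 : ∀ a ∉ ({11, 12, 13, 14, 17} : Finset ℕ), ∀ z, s₁ a z = s a z := f1.agree
  have hs1 : HasInput n V σ s₁ := ⟨by rw [ag1 0 (by decide), hs.mem0],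
    fun a b ha hb => by rw [ag1 1 (by decide), hs.mem1 a b ha hb],
    by rw [ag1 2 (by decide), hs.mem2], by rw [ag1 3 (by decide), hs.mem3]⟩
  refine (mergeSign_achieves (i := i) (j := j) hV hσ hs1 (by omega) hj (by rw [ag1 8 (by decide), h8])
    (by rw [ag1 9 (by decide), h9])).seq
    (B₂ := 256 * ((h - i) * (j - h)) + 153) (by omega) ?_
  rintro s₂ rfl
  refine Achieves.write_seq (by simp only [Expr.cost]; omega) ?_
  have e11 : Expr.eval (s₁.store 16 0 (if V i j = σ then 1 else 0))
      ((Expr.var 10).sub (.var 8)) = (h : ℤ) - i := by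
    simp only [Expr.eval, Memory.store_apply, Nat.reduceEqDiff, false_and, if_false,
      ag1 8 (by decide), ag1 10 (by decide), h8, h10]
    ring
  rw [e11]
  simp only [Expr.eval]
  set ε : ℤ := if V i j = σ then 1 else 0 with hε
  set s₃ := (s₁.store 16 0 ε).store 11 0 ((h : ℤ) - i) with hs3
  have ag3 : ∀ a ∉ ({11, 12, 13, 14, 16, 17} : Finset ℕ), ∀ z, s₃ a z = s a z := by
    intro a ha z
    simp only [Finset.mem_insert, Finset.mem_singleton, not_or] at ha
    simp only [hs3, Memory.store_apply, ha.1, ha.2.2.2.2.1, false_and, if_false]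
    refine ag1 a ?_ z
    simp only [Finset.mem_insert, Finset.mem_singleton, not_or]
    tauto
  have h3_14 : ∀ z, s₃ 14 z = s₁ 14 z := fun z => by
    simp only [hs3, Memory.store_apply, Nat.reduceEqDiff, false_and, if_false]
  have h3_13 : ∀ z, s₃ 13 z = s₁ 13 z := fun z => by
    simp only [hs3, Memory.store_apply, Nat.reduceEqDiff, false_and, if_false]
  let L : ℕ → ℤ := fun u => pathWeight (n + 1) (edgeWeight fun a b => V a b = σ) (u + 1) i h
  let R : ℕ → ℤ := fun v => pathWeight (n + 1) (edgeWeight fun a b => V a b = σ) (v + 1) h j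
  let D : ℕ → ℕ → ℤ := fun u v =>
    passingWeight (n + 1) (edgeWeight fun a b => V a b = σ) h j u v i
  have hd : MergeData n i h j L R D s₃ := by
    refine ⟨hih, hhj, hj, ?_, ?_, ?_, ?_, fun u hu => ?_, fun v hv => ?_, fun u v => ?_,
      fun u v huv => ?_⟩
    · rw [ag3 3 (by decide), hs.mem3]
    · rw [ag3 8 (by decide), h8]
    · rw [ag3 9 (by decide), h9]
    · rw [ag3 10 (by decide), h10]
    · rw [h3_14, f1.other, hl.weight _ (by omega) (by omega)]
      intro l hl h
      have := tripleIndex_inj (by omega) (by omega) (by omega) (by omega) h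
      omega
    · rw [h3_14, f1.other, hr.weight _ (by omega) (by omega)]
      intro l hl h
      have := tripleIndex_inj (by omega) (by omega) (by omega) (by omega) h
      omega
    · have h16 : s₃ 16 0 = ε := by
        simp only [hs3, Memory.store_apply, Nat.reduceEqDiff, false_and, if_false, and_self,
          if_true]
      simp only [D, L, R, h16]
      rw [hV.passingWeight_node hσ hj hsp u v, hε]
      push_cast
      ring
    · simp only [D]
      rw [passingWeight_eq_zero hw (by omega), Nat.cast_zero]
  have hinit : RowInv n i h j L R D s₃ (h - i) s₃ := by
    refine ⟨⟨fun _ _ _ => rfl, fun _ _ => rfl⟩, le_rfl, ?_, fun v hv => ?_, fun r _ hr => ?_⟩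
    · simp only [hs3, Memory.store_apply, and_self, if_true]
      rw [Nat.cast_sub hih.le]
    -- The cleared row is the row `u = h - i` of `D`, which vanishes.
    · rw [h3_13, (z1 v (by omega)).1, hd.zero _ _ (Or.inl le_rfl)]
    · rw [h3_14, (z1 r (by omega)).2, Finset.Ico_self, Finset.sum_empty]
  refine (mergeRows_achieves hd hinit).seq (B₂ := 100) (by simp only [Expr.cost]; omega) ?_
  rintro s₄ ⟨f4, -, -, row4, w4⟩
  have ag4 : ∀ a ∉ ({11, 12, 13, 14, 16, 17} : Finset ℕ), ∀ z, s₄ a z = s a z := by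
    intro a ha z
    rw [f4.agree a _ z, ag3 a ha z]
    simp only [Finset.mem_insert, Finset.mem_singleton, not_or] at ha ⊢
    tauto
  have h16 : s₄ 16 0 = ε := by
    rw [f4.agree 16 (by decide)]
    simp only [hs3, Memory.store_apply, Nat.reduceEqDiff, false_and, if_false, and_self, if_true]
  refine Achieves.write (by decide) ?_
  have p1 : (i : ℤ) * ((n : ℤ) + 1) + j = pairIndex n i j := rfl
  have p2 : (i : ℤ) * ((n : ℤ) + 1) + h = pairIndex n i h := rfl
  have p3 : (h : ℤ) * ((n : ℤ) + 1) + j = pairIndex n h j := rfl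
  have r0 := row4 0 (Nat.zero_le _)
  rw [Nat.cast_zero] at r0
  simp only [Expr.eval, ag4 3 (by decide), ag4 8 (by decide), ag4 9 (by decide),
    ag4 10 (by decide), ag4 15 (by decide), hs.mem3, h8, h9, h10, p1, p2, p3, hl.count, hr.count,
    h16, r0]
  have hsolved : IsSolved n V σ (s₄.store 15 (pairIndex n i j) (D 0 0 + (1 + -1 * ε) *
      (maxCount (fun a b => V a b = σ) i h * maxCount (fun a b => V a b = σ) h j))) i j := by
    refine ⟨fun k hk hk' => ?_, ?_⟩
    · simp only [Memory.store_apply, Nat.reduceEqDiff, false_and, if_false]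
      rw [w4 k hk hk', pathWeight_eq_sum_box hw hih hhj (by omega) hk, ← Finset.range_eq_Ico]
      push_cast
      simp only [contribution, L, R, D]
    · simp only [Memory.store_apply, and_self, if_true]
      rw [hV.maxCount_node hσ hj hsp, hε]
      simp only [D]
      split_ifs <;> push_cast <;> ring
  refine ⟨fun a ha z => ?_, hsolved.keep hj (fun z hz => ?_) fun z hz => ?_, hsolved⟩
  · simp only [Finset.mem_insert, Finset.mem_singleton, not_or] at ha
    simp only [Memory.store_apply, ha.2.2.2.2.1, false_and, if_false]
    refine ag4 a ?_ z
    simp only [Finset.mem_insert, Finset.mem_singleton, not_or]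
    tauto
  · simp only [Memory.store_apply, Nat.reduceEqDiff, false_and, if_false]
    rw [f4.other z hz, h3_14, f1.other z hz]
  · simp only [Memory.store_apply, hz, and_false, if_false]
    exact ag4 15 (by decide) z

theorem leaf_achieves (hV : IsSeparableTriangle n V) (hσ : σ = 1 ∨ σ = -1)
    (hs : HasInput n V σ s) (hi : i + 1 ≤ n) (h8 : s 8 0 = i) (h9 : s 9 0 = (i + 1 : ℕ)) :
    Achieves leaf s 50 (Solves n V σ s i (i + 1)) := by
  unfold leaf
  refine Achieves.write_seq (by decide) ?_
  refine Achieves.write (by decide) ?_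
  have p1 : (i : ℤ) * ((n : ℤ) + 1) + ((i + 1 : ℕ) : ℤ) = pairIndex n i (i + 1) := rfl
  have p2 : pairIndex n i (i + 1) * ((n : ℤ) + 1) + 1 = tripleIndex n i (i + 1) 1 := rfl
  simp only [Expr.eval, Memory.store_apply, Nat.reduceEqDiff, false_and, if_false, hs.mem3, h8, h9,
    p1, p2]
  have hsolved : IsSolved n V σ ((s.store 14 (tripleIndex n i (i + 1) 1) 1).store 15
      (pairIndex n i (i + 1)) 1) i (i + 1) := by
    refine ⟨fun k hk hk' => ?_, ?_⟩
    · obtain rfl : k = 1 := by omega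
      simp only [Memory.store_apply, Nat.reduceEqDiff, false_and, if_false, and_self, if_true]
      rw [hV.pathWeight_leaf hσ hi, Nat.cast_one]
    · simp only [Memory.store_apply, and_self, if_true]
      rw [maxCount_succ (hV.skips hσ), Nat.cast_one]
  refine ⟨fun a ha z => ?_, hsolved.keep hi (fun z hz => ?_) fun z hz => ?_, hsolved⟩
  · simp only [Finset.mem_insert, Finset.mem_singleton, not_or] at ha
    simp only [Memory.store_apply, ha.2.2.2.1, ha.2.2.2.2.1, false_and, if_false]
  · simp only [Memory.store_apply, Nat.reduceEqDiff, false_and, if_false, hz 1 (by omega),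
      and_false]
  · simp only [Memory.store_apply, Nat.reduceEqDiff, false_and, if_false, hz, and_false]

/-- The scan goes left from `j - 1` and inspects only row `i`. It takes at most `j - h` iterations,
which the cost of the later merge at `h` dominates. -/
theorem scan_achieves (hV : IsSeparableTriangle n V) (hs : HasInput n V σ s) (hij : i + 1 < j)
    (hj : j ≤ n) (h8 : s 8 0 = i) (h9 : s 9 0 = j) :
    ∃ h, IsSplit (fun a b => V a b = V i j) i h j ∧
      Achieves scan s (50 * ((h - i) * (j - h)) + 50) fun s' => s' = s.store 10 0 h := by
  classical
  have hex : ∃ h, i < h ∧ h < j ∧ V i h * V i j ≤ 0 ∧ ∀ k, h < k → k < j → 0 < V i k * V i j := by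
    -- The zero entry of the chain edge at `i` stops the scan at the latest.
    have h1 : V i (i + 1) * V i j ≤ 0 := by rw [hV.zero i (i + 1) le_rfl, zero_mul]
    let P : ℕ → Prop := fun k => k < j ∧ V i k * V i j ≤ 0
    have hP1 : P (i + 1) := ⟨hij, h1⟩
    have hle : i + 1 ≤ Nat.findGreatest P j := Nat.le_findGreatest hij.le hP1
    have hspec : P (Nat.findGreatest P j) := Nat.findGreatest_spec hij.le hP1
    refine ⟨Nat.findGreatest P j, hle, hspec.1, hspec.2, fun k hk hk' => ?_⟩
    by_contra hc
    exact Nat.findGreatest_is_greatest hk hk'.le ⟨hk', not_lt.1 hc⟩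
  obtain ⟨h, hih, hhj, hle, hgt⟩ := hex
  refine ⟨h, hV.isSplit_of_forall_gt hih hhj hj hle hgt, ?_⟩
  have hcost : j - h ≤ (h - i) * (j - h) := Nat.le_mul_of_pos_left _ (by omega)
  unfold scan
  refine Achieves.write_seq (by simp only [Expr.cost]; omega) ?_
  have e10 : Expr.eval s ((Expr.var 9).sub (.const 1)) = (j : ℤ) - 1 := by
    simp only [Expr.eval, h9]; ring
  rw [e10]
  simp only [Expr.eval]
  refine (Achieves.whilePos (B := 10) (Q := fun s' => s' = s.store 10 0 h)
    (fun m s' => h + m < j ∧ s' = s.store 10 0 ((h + m : ℕ) : ℤ)) (k := j - 1 - h) ?_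
    ⟨by omega, by congr 1; omega⟩).weaken (by simp only [Expr.cost]; omega) fun _ h => h
  rintro m s' ⟨hm, rfl⟩
  have e1 := hs.mem1 i j (by omega) hj
  have e2 := hs.mem1 i (h + m) (by omega) (by omega)
  rw [pairIndex] at e1 e2
  simp only [Expr.eval, Memory.store_apply, Nat.reduceEqDiff, false_and, and_self, if_false,
    if_true, hs.mem3, h8, h9, e1, e2]
  cases m with
  | zero => left; exact ⟨hle, rfl⟩
  | succ m =>
    right
    refine ⟨hgt _ (by omega) hm, m, rfl, Achieves.write (by decide) ⟨by omega, ?_⟩⟩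
    simp only [Expr.eval, Memory.store_apply, and_self, if_true]
    funext a
    funext z
    simp only [Memory.store_apply]
    split_ifs
    · push_cast; ring
    · rfl

end Node

end RAM

namespace RAM

/-! ### The recursion on the stack and its total cost -/

section Stack

variable {n : ℕ} {V : ℕ → ℕ → ℤ} {σ : ℤ} {s : Memory}

theorem IsSolved.congr {s' : Memory} {i j : ℕ} (h : IsSolved n V σ s i j)
    (h14 : ∀ z, s' 14 z = s 14 z) (h15 : ∀ z, s' 15 z = s 15 z) : IsSolved n V σ s' i j :=
  ⟨fun k hk hk' => (h14 _).trans (h.weight k hk hk'), (h15 _).trans h.count⟩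

theorem HasInput.congr {s' : Memory} (hs : HasInput n V σ s)
    (h : ∀ a ∈ ({0, 1, 2, 3} : Finset ℕ), ∀ z, s' a z = s a z) : HasInput n V σ s' :=
  ⟨by rw [h 0 (by decide), hs.mem0], fun a b ha hb => by rw [h 1 (by decide), hs.mem1 a b ha hb],
    by rw [h 2 (by decide), hs.mem2], by rw [h 3 (by decide), hs.mem3]⟩

/-- The entry in slot `m` of the stack. -/
def HasSlot (s : Memory) (m : ℕ) (x y z : ℤ) : Prop :=
  s 5 m = x ∧ s 6 m = y ∧ s 7 m = z

/-- The memory `s'` results from `s` by pushing to a stack of height `m`. -/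
structure IsPush (m : ℕ) (x y z : ℤ) (s s' : Memory) : Prop where
  height : s' 4 0 = (m + 1 : ℕ)
  top : HasSlot s' (m + 1) x y z
  below : ∀ k ≤ m, ∀ x y z, HasSlot s k x y z → HasSlot s' k x y z
  agree : ∀ a ∉ ({4, 5, 6, 7} : Finset ℕ), ∀ z, s' a z = s a z

theorem push_achieves {m : ℕ} {x y z : Expr} {X Y Z : ℤ} (h4 : s 4 0 = m)
    (hx : x.cost ≤ 2) (hy : y.cost ≤ 2) (hz : z.cost ≤ 2)
    (h : ∀ s' : Memory, (∀ a ∉ ({4, 5, 6, 7} : Finset ℕ), ∀ z, s' a z = s a z) →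
      x.eval s' = X ∧ y.eval s' = Y ∧ z.eval s' = Z) :
    Achieves (push x y z) s 50 (IsPush m X Y Z s) := by
  unfold push
  have e4 : Expr.eval s ((Expr.var 4).add (.const 1)) = (m + 1 : ℕ) := by
    simp only [Expr.eval, h4]; push_cast; rfl
  refine Achieves.write_seq (by decide) ?_
  rw [e4]
  simp only [Expr.eval]
  refine Achieves.write_seq (by simp only [Expr.cost]; omega) ?_
  rw [(h (s.store 4 0 ((m + 1 : ℕ) : ℤ)) ?_).1]
  swap
  · intro a ha w
    simp only [Finset.mem_insert, Finset.mem_singleton, not_or] at ha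
    simp only [Memory.store_apply, ha.1, false_and, if_false]
  simp only [Expr.eval, Memory.store_apply, and_self, if_true]
  refine Achieves.write_seq (by simp only [Expr.cost]; omega) ?_
  rw [(h ((s.store 4 0 ((m + 1 : ℕ) : ℤ)).store 5 ((m + 1 : ℕ) : ℤ) X) ?_).2.1]
  swap
  · intro a ha w
    simp only [Finset.mem_insert, Finset.mem_singleton, not_or] at ha
    simp only [Memory.store_apply, ha.1, ha.2.1, false_and, if_false]
  simp only [Expr.eval, Memory.store_apply, and_self, if_true, Nat.reduceEqDiff, false_and,
    if_false]
  refine Achieves.write (by simp only [Expr.cost]; omega) ?_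
  rw [(h (((s.store 4 0 ((m + 1 : ℕ) : ℤ)).store 5 ((m + 1 : ℕ) : ℤ) X).store 6
    ((m + 1 : ℕ) : ℤ) Y) ?_).2.2]
  swap
  · intro a ha w
    simp only [Finset.mem_insert, Finset.mem_singleton, not_or] at ha
    simp only [Memory.store_apply, ha.1, ha.2.1, ha.2.2.1, false_and, if_false]
  simp only [Expr.eval, Memory.store_apply, and_self, if_true, Nat.reduceEqDiff, false_and,
    if_false]
  refine ⟨?_, ?_, fun k hk x y z hs => ?_, fun a ha w => ?_⟩
  · simp only [Memory.store_apply, and_self, if_true, Nat.reduceEqDiff, false_and, if_false]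
  · simp only [HasSlot, Memory.store_apply, and_self, if_true, Nat.reduceEqDiff, false_and,
      if_false]
  · have hne : ¬ (k : ℤ) = ((m + 1 : ℕ) : ℤ) := by omega
    simp only [HasSlot, Memory.store_apply, Nat.reduceEqDiff, false_and, if_false, hne, and_false]
    exact hs
  · simp only [Finset.mem_insert, Finset.mem_singleton, not_or] at ha
    simp only [Memory.store_apply, ha, false_and, if_false]

theorem pop_achieves {m : ℕ} {x y z : ℤ} (h4 : s 4 0 = (m + 1 : ℕ))
    (hs : HasSlot s (m + 1) x y z) :
    Achieves pop s 50 fun s' => s' 4 0 = m ∧ s' 8 0 = x ∧ s' 9 0 = y ∧ s' 10 0 = z ∧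
      ∀ a ∉ ({4, 8, 9, 10} : Finset ℕ), ∀ z, s' a z = s a z := by
  unfold pop
  iterate 3 refine Achieves.write_seq (by decide) ?_
  refine Achieves.write (by decide) ?_
  obtain ⟨h5, h6, h7⟩ := hs
  simp only [Expr.eval, Memory.store_apply, Nat.reduceEqDiff, false_and, and_self, if_false,
    if_true, h4, h5, h6, h7]
  refine ⟨by push_cast; ring, trivial, trivial, trivial, fun a ha w => ?_⟩
  simp only [Finset.mem_insert, Finset.mem_singleton, not_or] at ha
  simp only [ha, false_and, if_false]

/-- The memory after splitting the interval from `i` to `j` at `h`, where `m` is the height of the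
stack at the beginning. -/
structure IsVisited (m i h j : ℕ) (s s' : Memory) : Prop where
  height : s' 4 0 = (m + 3 : ℕ)
  slot₁ : HasSlot s' (m + 1) i j h
  slot₂ : HasSlot s' (m + 2) i h 0
  slot₃ : HasSlot s' (m + 3) h j 0
  below : ∀ k ≤ m, ∀ x y z, HasSlot s k x y z → HasSlot s' k x y z
  agree : ∀ a ∉ ({4, 5, 6, 7, 10} : Finset ℕ), ∀ z, s' a z = s a z

theorem visit_achieves {m i j : ℕ} (hV : IsSeparableTriangle n V) (hs : HasInput n V σ s)
    (hij : i + 1 < j) (hj : j ≤ n) (h8 : s 8 0 = i) (h9 : s 9 0 = j) (h4 : s 4 0 = m) :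
    ∃ h, IsSplit (fun a b => V a b = V i j) i h j ∧
      Achieves visit s (50 * ((h - i) * (j - h)) + 200) (IsVisited m i h j s) := by
  obtain ⟨h, hsp, hscan⟩ := scan_achieves hV hs hij hj h8 h9
  refine ⟨h, hsp, ?_⟩
  unfold visit
  refine hscan.seq (B₂ := 150) (by omega) ?_
  rintro s₁ rfl
  set s₁ := s.store 10 0 (h : ℤ) with hs1
  have a1 : ∀ a ≠ 10, ∀ z, s₁ a z = s a z := fun a ha z => by
    simp only [hs1, Memory.store_apply, ha, false_and, if_false]
  have h10 : s₁ 10 0 = h := by simp only [hs1, Memory.store_apply, and_self, if_true]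
  have h8' : s₁ 8 0 = i := by rw [a1 8 (by decide), h8]
  have h9' : s₁ 9 0 = j := by rw [a1 9 (by decide), h9]
  refine (push_achieves (m := m) (X := i) (Y := j) (Z := h) (by rw [a1 4 (by decide), h4])
    (by decide) (by decide) (by decide) fun s' h => ?_).seq (B₂ := 100) (by omega) fun s₂ p2 => ?_
  · simp only [Expr.eval, h 8 (by decide), h 9 (by decide), h 10 (by decide), h8', h9', h10,
      and_self]
  refine (push_achieves (m := m + 1) (X := i) (Y := h) (Z := 0) p2.height
    (by decide) (by decide) (by decide) fun s' h => ?_).seq (B₂ := 50) (by omega) fun s₃ p3 => ?_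
  · simp only [Expr.eval, h 8 (by decide), h 10 (by decide), p2.agree 8 (by decide),
      p2.agree 10 (by decide), h8', h10, and_self]
  refine (push_achieves (m := m + 2) (X := h) (Y := j) (Z := 0) p3.height
    (by decide) (by decide) (by decide) fun s' h => ?_).weaken le_rfl fun s₄ p4 => ?_
  · simp only [Expr.eval, h 9 (by decide), h 10 (by decide), p3.agree 9 (by decide),
      p3.agree 10 (by decide), p2.agree 9 (by decide), p2.agree 10 (by decide), h9', h10, and_self]
  refine ⟨p4.height, p4.below _ (by omega) _ _ _ (p3.below _ (by omega) _ _ _ p2.top),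
    p4.below _ (by omega) _ _ _ p3.top, p4.top, fun k hk x y z hslot => ?_, fun a ha z => ?_⟩
  · refine p4.below _ (by omega) _ _ _ (p3.below _ (by omega) _ _ _ (p2.below _ hk _ _ _ ?_))
    exact ⟨(a1 5 (by decide) _).trans hslot.1, (a1 6 (by decide) _).trans hslot.2.1,
      (a1 7 (by decide) _).trans hslot.2.2⟩
  · simp only [Finset.mem_insert, Finset.mem_singleton, not_or] at ha
    have hb : a ∉ ({4, 5, 6, 7} : Finset ℕ) := by
      simp only [Finset.mem_insert, Finset.mem_singleton, not_or]; tauto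
    rw [p4.agree a hb, p3.agree a hb, p2.agree a hb, a1 a ha.2.2.2.2]

/-- The interval from `i` to `j` has been removed from the stack and solved. -/
structure IsFinished (n : ℕ) (V : ℕ → ℕ → ℤ) (σ : ℤ) (m i j : ℕ) (s s' : Memory) : Prop where
  height : s' 4 0 = m
  below : ∀ k ≤ m, ∀ x y z, HasSlot s k x y z → HasSlot s' k x y z
  agree : ∀ a ∈ ({0, 1, 2, 3, 18} : Finset ℕ), ∀ z, s' a z = s a z
  keep : ∀ a b, b ≤ n → IsSolved n V σ s a b → IsSolved n V σ s' a b
  solved : IsSolved n V σ s' i j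

theorem Solves.isFinished {m i j : ℕ} {s₁ s' : Memory} (h : Solves n V σ s₁ i j s')
    (h4 : s₁ 4 0 = m) (h₁ : ∀ a ∉ ({4, 8, 9, 10} : Finset ℕ), ∀ z, s₁ a z = s a z) :
    IsFinished n V σ m i j s s' := by
  refine ⟨by rw [h.agree 4 (by decide), h4], fun k _ x y z hslot => ?_, fun a ha z => ?_,
    fun a b hb hab => h.keep a b hb (hab.congr (h₁ 14 (by decide)) (h₁ 15 (by decide))), h.solved⟩
  · exact ⟨by rw [h.agree 5 (by decide), h₁ 5 (by decide), hslot.1],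
      by rw [h.agree 6 (by decide), h₁ 6 (by decide), hslot.2.1],
      by rw [h.agree 7 (by decide), h₁ 7 (by decide), hslot.2.2]⟩
  · have hb : a ∉ ({11, 12, 13, 14, 15, 16, 17} : Finset ℕ) ∧ a ∉ ({4, 8, 9, 10} : Finset ℕ) := by
      simp only [Finset.mem_insert, Finset.mem_singleton] at ha ⊢; omega
    rw [h.agree a hb.1, h₁ a hb.2]

theorem step_leaf {m i : ℕ} (hV : IsSeparableTriangle n V) (hσ : σ = 1 ∨ σ = -1)
    (hs : HasInput n V σ s) (hi : i + 1 ≤ n) (h4 : s 4 0 = (m + 1 : ℕ))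
    (hslot : HasSlot s (m + 1) i (i + 1 : ℕ) 0) :
    Achieves step s 150 (IsFinished n V σ m i (i + 1) s) := by
  unfold step
  refine (pop_achieves h4 hslot).seq (B₂ := 100) (by omega) ?_
  rintro s₁ ⟨g4, g8, g9, g10, ag⟩
  refine Achieves.ifPos (B := 80) (by decide) (fun he => ?_) fun _ => ?_
  · simp only [Expr.eval, g10, lt_irrefl] at he
  refine Achieves.ifPos (B := 50) (by decide) (fun he => ?_) fun _ => ?_
  · simp only [Expr.eval, g8, g9] at he
    push_cast at he
    omega
  exact (leaf_achieves hV hσ (hs.congr fun a ha z => ag a (by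
    simp only [Finset.mem_insert, Finset.mem_singleton] at ha ⊢; omega) z) hi g8 g9).weaken
    le_rfl fun s' h => h.isFinished g4 ag

theorem step_visit {m i j : ℕ} (hV : IsSeparableTriangle n V) (hs : HasInput n V σ s)
    (hij : i + 1 < j) (hj : j ≤ n) (h4 : s 4 0 = (m + 1 : ℕ))
    (hslot : HasSlot s (m + 1) i j 0) :
    ∃ h s₁, IsSplit (fun a b => V a b = V i j) i h j ∧
      (∀ a ∉ ({4, 8, 9, 10} : Finset ℕ), ∀ z, s₁ a z = s a z) ∧
      Achieves step s (50 * ((h - i) * (j - h)) + 300) (IsVisited m i h j s₁) := by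
  obtain ⟨t, s₁, hrun, ht, g4, g8, g9, g10, ag⟩ := pop_achieves h4 hslot
  have hs1 : HasInput n V σ s₁ := hs.congr fun a ha z => ag a (by
    simp only [Finset.mem_insert, Finset.mem_singleton] at ha ⊢; omega) z
  obtain ⟨h, hsp, hvisit⟩ := visit_achieves hV hs1 hij hj g8 g9 g4
  refine ⟨h, s₁, hsp, ag, ?_⟩
  unfold step
  refine Achieves.seq (Q := fun s' => s' = s₁) ⟨t, s₁, hrun, ht, rfl⟩
    (B₂ := 50 * ((h - i) * (j - h)) + 250) (by omega) ?_
  rintro _ rfl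
  refine Achieves.ifPos (B := 50 * ((h - i) * (j - h)) + 240) (by simp only [Expr.cost]; omega)
    (fun he => ?_) fun _ => ?_
  · simp only [Expr.eval, g10, lt_irrefl] at he
  refine Achieves.ifPos (B := 50 * ((h - i) * (j - h)) + 200) (by simp only [Expr.cost]; omega)
    (fun _ => hvisit) fun he => ?_
  simp only [Expr.eval, g8, g9] at he
  omega

theorem step_merge {m i h j : ℕ} (hV : IsSeparableTriangle n V) (hσ : σ = 1 ∨ σ = -1)
    (hs : HasInput n V σ s) (hj : j ≤ n) (hsp : IsSplit (fun a b => V a b = V i j) i h j)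
    (h4 : s 4 0 = (m + 1 : ℕ)) (hslot : HasSlot s (m + 1) i j h)
    (hl : IsSolved n V σ s i h) (hr : IsSolved n V σ s h j) :
    Achieves step s (1000 * ((h - i) * (j - h)) + 100) (IsFinished n V σ m i j s) := by
  unfold step
  refine (pop_achieves h4 hslot).seq (B₂ := 1000 * ((h - i) * (j - h)) + 50) (by omega) ?_
  rintro s₁ ⟨g4, g8, g9, g10, ag⟩
  have hih := hsp.1
  refine Achieves.ifPos (B := 1000 * ((h - i) * (j - h))) (by simp only [Expr.cost]; omega)
    (fun _ => ?_) fun he => ?_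
  · refine (merge_achieves hV hσ (hs.congr fun a ha z => ag a (by
      simp only [Finset.mem_insert, Finset.mem_singleton] at ha ⊢; omega) z) hj hsp g8 g9 g10
      (hl.congr (ag 14 (by decide)) (ag 15 (by decide)))
      (hr.congr (ag 14 (by decide)) (ag 15 (by decide)))).weaken le_rfl
      fun s' h => h.isFinished g4 ag
  · simp only [Expr.eval, g10] at he
    omega

/-- Strong induction on the length. After a visit, the stack holds the right part on top of the left
part on top of the interval marked with `h`. The induction hypothesis removes the two parts in turn,
preserving everything below them, and the marked interval is merged. -/
theorem solve_reaches (hV : IsSeparableTriangle n V) (hσ : σ = 1 ∨ σ = -1) {m i j : ℕ}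
    (hs : HasInput n V σ s) (hij : i < j) (hj : j ≤ n) (h4 : s 4 0 = (m + 1 : ℕ))
    (hslot : HasSlot s (m + 1) i j 0) :
    Reaches (.var 4) step s (1000 * (j - i) ^ 2) (IsFinished n V σ m i j s) := by
  induction hd : j - i using Nat.strong_induction_on generalizing i j m s with
  | _ d ih =>
  have hpos : ∀ {s : Memory} {m : ℕ}, s 4 0 = (m + 1 : ℕ) → 0 < (Expr.var 4).eval s := by
    intro s m h
    simp only [Expr.eval, h]
    omega
  by_cases hleaf : j = i + 1
  · subst hleaf
    refine Reaches.single (hpos h4) ?_ (step_leaf hV hσ hs hj h4 hslot)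
    obtain rfl : d = 1 := by omega
    decide
  obtain ⟨h, s₁, hsp, ag, hvisit⟩ := step_visit hV hs (by omega) hj h4 hslot
  have hih := hsp.1
  have hhj := hsp.2.1
  -- In `1000 * d ^ 2` the mixed term is `2000 * ((h - i) * (j - h))`. It pays for the visit and the
  -- merge, including `406` extra steps, because the product is at least `1`.
  have hcost : 1050 * ((h - i) * (j - h)) + 406 + 1000 * (j - h) ^ 2 + 1000 * (h - i) ^ 2 ≤
      1000 * d ^ 2 := by
    have h1 : 1 ≤ (h - i) * (j - h) := Nat.mul_pos (by omega) (by omega)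
    have h2 : d = (h - i) + (j - h) := by omega
    rw [h2]
    nlinarith
  refine (Reaches.single (B' := 50 * ((h - i) * (j - h)) + 303) (hpos h4)
    (by simp only [Expr.cost]; omega) hvisit).trans
    (B₂ := 1000 * ((h - i) * (j - h)) + 103 + 1000 * (j - h) ^ 2 + 1000 * (h - i) ^ 2)
    (by omega) fun s₂ v2 => ?_
  have c2 : ∀ a ∉ ({4, 5, 6, 7, 8, 9, 10} : Finset ℕ), ∀ z, s₂ a z = s a z := by
    intro a ha z
    simp only [Finset.mem_insert, Finset.mem_singleton, not_or] at ha
    rw [v2.agree a (by simp only [Finset.mem_insert, Finset.mem_singleton, not_or]; tauto),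
      ag a (by simp only [Finset.mem_insert, Finset.mem_singleton, not_or]; tauto)]
  have i2 : HasInput n V σ s₂ := hs.congr fun a ha z => c2 a (by
    simp only [Finset.mem_insert, Finset.mem_singleton] at ha ⊢; omega) z
  refine (ih (j - h) (by omega) i2 hhj hj v2.height v2.slot₃ rfl).trans
    (B₂ := 1000 * ((h - i) * (j - h)) + 103 + 1000 * (h - i) ^ 2) (by omega) fun s₃ f3 => ?_
  have i3 : HasInput n V σ s₃ := i2.congr fun a ha z => f3.agree a (by
    simp only [Finset.mem_insert, Finset.mem_singleton] at ha ⊢; omega) z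
  refine (ih (h - i) (by omega) i3 hih (by omega) f3.height
    (f3.below _ le_rfl _ _ _ v2.slot₂) rfl).trans
    (B₂ := 1000 * ((h - i) * (j - h)) + 103) (by omega) fun s₄ f4 => ?_
  have i4 : HasInput n V σ s₄ := i3.congr fun a ha z => f4.agree a (by
    simp only [Finset.mem_insert, Finset.mem_singleton] at ha ⊢; omega) z
  have hmerge := step_merge hV hσ i4 hj hsp f4.height
    (f4.below _ le_rfl _ _ _ (f3.below _ (by omega) _ _ _ v2.slot₁)) f4.solved
    (f4.keep _ _ hj f3.solved)
  refine Reaches.single (hpos f4.height) (by simp only [Expr.cost]; omega)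
    (hmerge.weaken le_rfl fun s₅ f5 => ?_)
  refine ⟨f5.height, fun k hk x y z hslot' => ?_, fun a ha z => ?_, fun a b hb hab => ?_,
    f5.solved⟩
  · refine f5.below k hk _ _ _ (f4.below k (by omega) _ _ _ (f3.below k (by omega) _ _ _
      (v2.below k hk _ _ _ ?_)))
    exact ⟨(ag 5 (by decide) _).trans hslot'.1, (ag 6 (by decide) _).trans hslot'.2.1,
      (ag 7 (by decide) _).trans hslot'.2.2⟩
  · rw [f5.agree a ha, f4.agree a ha, f3.agree a ha, c2 a (by
      simp only [Finset.mem_insert, Finset.mem_singleton] at ha ⊢; omega)]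
  · exact f5.keep a b hb (f4.keep a b hb (f3.keep a b hb
      (hab.congr (c2 14 (by decide)) (c2 15 (by decide)))))

/-- No cells are assumed to be empty: a merge clears the cells that it accumulates in, and a leaf
overwrites its own. The second sign can therefore reuse the memory of the first. -/
theorem countSign_achieves (hV : IsSeparableTriangle n V) (hσ : σ = 1 ∨ σ = -1) (hn : 1 ≤ n)
    (hs : HasInput n V σ s) :
    Achieves countSign s (1000 * n ^ 2 + 100) fun s' =>
      s' 15 n = maxCount (fun a b => V a b = σ) 0 n ∧
        ∀ a ∈ ({0, 1, 2, 3, 18} : Finset ℕ), ∀ z, s' a z = s a z := by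
  unfold countSign
  refine Achieves.write_seq (by simp only [Expr.cost]; omega) ?_
  simp only [Expr.eval]
  set s₁ := s.store 4 0 0 with hs1
  have a1 : ∀ a ≠ 4, ∀ z, s₁ a z = s a z := fun a ha z => by
    simp only [hs1, Memory.store_apply, ha, false_and, if_false]
  refine (push_achieves (m := 0) (X := ((0 : ℕ) : ℤ)) (Y := n) (Z := 0)
    (by simp only [hs1, Memory.store_apply, and_self, if_true, Nat.cast_zero]) (by decide)
    (by decide) (by decide) fun s' h => ?_).seq (B₂ := 1000 * n ^ 2 + 10)
    (by simp only [Expr.cost]; omega) fun s₂ p2 => ?_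
  · simp only [Expr.eval, h 0 (by decide), a1 0 (by decide), hs.mem0, Nat.cast_zero, and_self]
  have c2 : ∀ a ∈ ({0, 1, 2, 3, 18} : Finset ℕ), ∀ z, s₂ a z = s a z := by
    intro a ha z
    simp only [Finset.mem_insert, Finset.mem_singleton] at ha
    rw [p2.agree a (by simp only [Finset.mem_insert, Finset.mem_singleton]; omega),
      a1 a (by omega)]
  have i2 : HasInput n V σ s₂ := hs.congr fun a ha z => c2 a (by
    simp only [Finset.mem_insert, Finset.mem_singleton] at ha ⊢; omega) z
  refine ((solve_reaches hV hσ i2 hn le_rfl p2.height p2.top).achieves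
    (by simp only [Expr.cost, Nat.sub_zero]; omega) fun s' h => ?_).weaken le_rfl fun s₃ f3 => ?_
  · simp only [Expr.eval, h.height]; rfl
  · refine ⟨?_, fun a ha z => by rw [f3.agree a ha, c2 a ha]⟩
    rw [← f3.solved.count]
    simp [pairIndex]

theorem countTriangulations_achieves (hV : IsSeparableTriangle n V) (hn : 1 ≤ n)
    (h0 : s 0 0 = n) (h1 : ∀ i j, i ≤ n → j ≤ n → s 1 (pairIndex n i j) = V i j) :
    Achieves countTriangulations s (3000 * n ^ 2) fun s' => s' 0 0 =
      ((maxCount (fun a b => V a b = 1) 0 n * maxCount (fun a b => V a b = -1) 0 n : ℕ) : ℤ) := by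
  have hn2 : 1 ≤ n ^ 2 := Nat.one_le_pow _ _ hn
  unfold countTriangulations
  refine Achieves.write_seq (by simp only [Expr.cost]; omega) ?_
  refine Achieves.write_seq (by simp only [Expr.cost]; omega) ?_
  simp only [Expr.eval, h0]
  have i1 : HasInput n V 1 ((s.store 3 0 ((n : ℤ) + 1)).store 2 0 1) := by
    refine ⟨?_, fun i j hi hj => ?_, ?_, ?_⟩ <;>
      simp only [Memory.store_apply, Nat.reduceEqDiff, OfNat.zero_ne_ofNat, OfNat.one_ne_ofNat,
        false_and, and_self, if_true, if_false]
    · exact h0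
    · exact h1 i j hi hj
  refine (countSign_achieves hV (Or.inl rfl) hn i1).seq (B₂ := 1000 * n ^ 2 + 200)
    (by simp only [Expr.cost]; omega) ?_
  rintro s₁ ⟨r1, a1⟩
  have j1 : HasInput n V 1 s₁ := i1.congr fun a ha z => a1 a (by
    simp only [Finset.mem_insert, Finset.mem_singleton] at ha ⊢; omega) z
  refine Achieves.write_seq (by simp only [Expr.cost]; omega) ?_
  refine Achieves.write_seq (by simp only [Expr.cost]; omega) ?_
  simp only [Expr.eval, j1.mem0, r1]
  set M₁ := maxCount (fun a b => V a b = 1) 0 n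
  have i2 : HasInput n V (-1) ((s₁.store 18 0 M₁).store 2 0 (-1)) := by
    refine ⟨?_, fun i j hi hj => ?_, ?_, ?_⟩ <;>
      simp only [Memory.store_apply, Nat.reduceEqDiff, OfNat.zero_ne_ofNat, OfNat.one_ne_ofNat,
        false_and, and_self, if_true, if_false]
    · exact j1.mem0
    · exact j1.mem1 i j hi hj
    · exact j1.mem3
  refine (countSign_achieves hV (Or.inr rfl) hn i2).seq (B₂ := 50)
    (by simp only [Expr.cost]; omega) ?_
  rintro s₂ ⟨r2, a2⟩
  have m0 : s₂ 0 0 = n := by rw [a2 0 (by decide), i2.mem0]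
  have m18 : s₂ 18 0 = M₁ := by
    rw [a2 18 (by decide)]
    simp only [Memory.store_apply, Nat.reduceEqDiff, false_and, and_self, if_true, if_false]
  refine Achieves.write (by decide) ?_
  simp only [Expr.eval, Memory.store_apply, and_self, if_true, m0, m18, r2]
  push_cast
  rfl

end Stack

end RAM

/-- There is one program that computes the number of triangulations of every chain from its
visibility triangle in `O(n ^ 2)` elementary steps, where `n` is the number of chain edges and
every integer addition and every integer multiplication counts as one step. -/
theorem theorem2 :
    ∃ (P : RAM.Program) (c : ℕ), ∀ (n : ℕ) (p : Fin (n + 1) → ℝ × ℝ), 1 ≤ n → IsPointChain p →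
      ∃ (t : ℕ) (s : RAM.Memory), RAM.Runs P (RAM.inputMemory (visibility p)) t s ∧
        s 0 0 = (triangulationCount p : ℤ) ∧ t ≤ c * n ^ 2 := by
  -- Each sign takes at most `1000 * n ^ 2 + 100` steps; for `n ≥ 1` the third `1000 * n ^ 2` covers
  -- all constants.
  refine ⟨RAM.countTriangulations, 3000, fun n p hn hp => ?_⟩
  obtain ⟨t, s, hrun, ht, hs⟩ := RAM.countTriangulations_achieves
    (s := RAM.inputMemory (visibility p)) hp.isSeparableTriangle hn rfl (fun i j hi hj => by
      have := RAM.inputMemory_entry (visibility p) ⟨i, by omega⟩ ⟨j, by omega⟩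
      rw [← visibilityNat_coe] at this
      exact this)
  exact ⟨t, s, hrun, by rw [hs, triangulationCount_eq hp], ht⟩
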